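/- Let $T\ge 1$, let $\sum_{j\ge1}|a(j)|<\infty$ with $a(j)\in\mathbb C$, and put $\vec a(j)=(a(jT+1),\dots,a(jT+T))^{\top}$ for $j\ge0$ and $A(e^{i\lambda})=\sum_{j\ge 0}\vec a(j)e^{ij\lambda}$. Let $s\ge 0$, $N_l,K_l\in\{0,1,2,\dots\}$ for $1\le l\le s$, $M_l=\sum_{k=1}^{l}(N_k+K_k)$, $\widetilde S=\bigcup_{l=1}^{s}\{-M_l,\dots,-M_{l-1}-N_l-1\}$ and $\Gamma=\widetilde S\cup\{0,1,2,\dots\}$. A spectral density is an integrable function $f$ on $(-\pi,\pi]$ whose values are (a.e.) positive semidefinite Hermitian $T\times T$ matrices. For such $f$ let $L_2(f)$ be the space of measurable $b:(-\pi,\pi]\to\mathbb C^T$ with $\int b^{\top}f\,\overline b\,d\lambda<\infty$, and let $L_2^s(f)$ be the closed linear span in $L_2(f)$ of the functions $e^{ij\lambda}\delta_\nu$, $j\in\{\dots,-2,-1\}\setminus\widetilde S$, $1\le\nu\le T$, where $\delta_\nu$ is the $\nu$-th unit vector. The mean square error of the linear estimate with spectral characteristic $h$ of the functional $A\vec\zeta=\sum_{j\ge0}\vec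 a(j)^{\top}\vec\zeta(j)$ of a $T$-variate stationary sequence $\vec\zeta$ with spectral density $f$, observed without noise at the times $\{\dots,-2,-1\}\setminus\widetilde S$, is $$\Delta(h;f)=\frac1{2\pi}\int_{-\pi}^{\pi}(A-h)^{\top}f\,\overline{(A-h)}\,d\lambda ,$$ and $\Delta(f)=\min_{h\in L_2^s(f)}\Delta(h;f)$; a minimizer is called an optimal spectral characteristic for $f$. Let $D_f$ be a set of spectral densities. A density $f^0\in D_f$ is called least favorable in $D_f$ if $\Delta(f^0)=\max_{f\in D_f}\Delta(f)$. With $H_D=\bigcap_{f\in D_f}L_2^s(f)$, a function $h^0\in H_D$ is called a minimax spectral characteristic if $\max_{f\in D_f}\Delta(h^0;f)$ exists and equals $\min_{h\in H_D}\sup_{f\in D_f}\Delta(h;f)$. Let $f^0\in D_f$ be invertible almost everywhere with $\int_{-\pi}^{\pi}\operatorname{Tr}\,(f^0(\lambda))^{-1}d\lambda<\infty$. Let $\mathbf B^0$ be the matrix with blocks $B^0(k-j)=\frac1{2\pi}\int_{-\pi}^{\pi}[(f^0(\lambda))^{-1}]^{\top}e^{i(j-k)\lambda}d\lambda$, $k,j\in\Gamma$,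 and let $\mathbf a=(\mathbf a(k))_{k\in\Gamma}$ with $\mathbf a(k)=\vec a(k)$ for $k\ge0$ and $\mathbf a(k)=0$ for $k\in\widetilde S$. Suppose that $\vec c^{\,0}=(\mathbf B^0)^{-1}\mathbf a$, in the sense that $\sum_{j\in\Gamma}B^0(k-j)\vec c^{\,0}(j)=\mathbf a(k)$ for all $k\in\Gamma$, and that the series $C^0(e^{i\lambda})=\sum_{n\in\Gamma}\vec c^{\,0}(n)e^{in\lambda}$ converges in $L_2((f^0)^{-1})$ (all sums over $\Gamma$ being taken in the natural order of the index). Put $h(f^0)^{\top}=A^{\top}-(C^0)^{\top}(f^0)^{-1}$. Suppose that $f^0$ maximizes over $f\in D_f$ the linear functional $$\Delta(h(f^0);f)=\frac1{2\pi}\int_{-\pi}^{\pi}C^0(e^{i\lambda})^{\top}(f^0(\lambda))^{-1}f(\lambda)(f^0(\lambda))^{-1}\overline{C^0(e^{i\lambda})}\,d\lambda .$$ Then $f^0$ is least favorable in $D_f$, and $h(f^0)$ is an optimal spectral characteristic for $f^0$. If moreover $h(f^0)\in H_D$, then $h(f^0)$ is a minimax spectral characteristic. -/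

import Mathlib

open MeasureTheory Filter Topology
open scoped ENNReal ComplexOrder

namespace MinimaxExtrapolation

noncomputable section

/-! ### Observation pattern -/

/-- `M_l = ∑_{k=1}^{l} (N_k + K_k)` (with `M_0 = 0`). -/
def offset (N K : ℕ → ℕ) (l : ℕ) : ℕ := ∑ k ∈ Finset.Icc 1 l, (N k + K k)

/-- The missing time points `⋃_{l=1}^{s} {-M_l, …, -M_{l-1} - N_l - 1}`: the `l`-th gap has length
`K_l`, and is separated from the preceding one by `N_l` observed points. -/
def missing (s : ℕ) (N K : ℕ → ℕ) : Finset ℤ :=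
  (Finset.Icc 1 s).biUnion fun l =>
    Finset.Icc (-(offset N K l : ℤ)) (-(offset N K (l - 1) : ℤ) - (N l : ℤ) - 1)

/-- The unobserved time points `Γ = S ∪ {0, 1, 2, …}`. -/
def unobserved (S : Finset ℤ) : Set ℤ := {n | n ∈ S ∨ 0 ≤ n}

/-- The observed time points `{…, -2, -1} \ S`. -/
def observed (S : Finset ℤ) : Set ℤ := {n | n < 0 ∧ n ∉ S}

/-- The part of `Γ` below `L`. -/
def unobservedBelow (S : Finset ℤ) (L : ℕ) : Finset ℤ := S ∪ Finset.Ico (0 : ℤ) (L : ℤ)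

variable {T : ℕ}

/-! ### Weighted spaces and spectral densities -/

/-- Lebesgue measure on `(-π, π]`. -/
def circleMeasure : Measure ℝ := volume.restrict (Set.Ioc (-Real.pi) Real.pi)

/-- The exponential `e^{i n x}`. -/
def expi (n : ℤ) (x : ℝ) : ℂ := Complex.exp (Complex.I * (n : ℂ) * (x : ℂ))

/-- The extended nonnegative number `(1/2π) ∫ b(x)ᵀ w(x) conj(b(x)) dx`; it is used for
(a.e.) positive semidefinite weights `w`, for which the integrand is real and nonnegative. -/
def weightedSq (w : ℝ → Matrix (Fin T) (Fin T) ℂ) (b : ℝ → Fin T → ℂ) : ℝ≥0∞ :=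
  ENNReal.ofReal (1 / (2 * Real.pi)) *
    ∫⁻ x, ENNReal.ofReal (b x ⬝ᵥ Matrix.mulVec (w x) (star (b x))).re ∂circleMeasure

/-- Spectral density matrices of `T`-variate stationary sequences: integrable, and positive
semidefinite almost everywhere. -/
def IsSpectralDensity (f : ℝ → Matrix (Fin T) (Fin T) ℂ) : Prop :=
  (∀ i j, Integrable (fun x => f x i j) circleMeasure) ∧ ∀ᵐ x ∂circleMeasure, (f x).PosSemidef

/-- The minimality condition `∫ Tr (f(x))⁻¹ dx < ∞`; it presupposes that `f(x)` is invertible for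
almost every `x`. -/
def Minimality (f : ℝ → Matrix (Fin T) (Fin T) ℂ) : Prop :=
  (∀ᵐ x ∂circleMeasure, IsUnit (f x).det) ∧
    Integrable (fun x => ((f x)⁻¹).trace) circleMeasure

/-- The trigonometric polynomial `∑_{n ∈ F} v(n) e^{inx}`. -/
def trigPoly (F : Finset ℤ) (v : ℤ → Fin T → ℂ) (x : ℝ) : Fin T → ℂ :=
  ∑ n ∈ F, expi n x • v n

/-- The space `L₂(f)`. -/
def L2 (f : ℝ → Matrix (Fin T) (Fin T) ℂ) : Set (ℝ → Fin T → ℂ) :=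
  {b | AEStronglyMeasurable b circleMeasure ∧ weightedSq f b < ∞}

/-- The subspace `L₂ˢ(f)` of `L₂(f)`: the closed linear span of the functions `e^{ijx} δ_ν`,
`j` an observed time point, `1 ≤ ν ≤ T`. -/
def L2s (S : Finset ℤ) (f : ℝ → Matrix (Fin T) (Fin T) ℂ) : Set (ℝ → Fin T → ℂ) :=
  {h | h ∈ L2 f ∧ ∀ ε : ℝ≥0∞, 0 < ε → ∃ (F : Finset ℤ) (v : ℤ → Fin T → ℂ),
    (∀ n ∈ F, n ∈ observed S) ∧ weightedSq f (fun x => h x - trigPoly F v x) < ε}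

/-! ### The functional and the estimation error -/

/-- The block coefficients of the functional `Aζ = ∑_{j ≥ 1} a(j) ζ(j)`: the component of number
`ν + 1` of `a⃗(j)` is `a(jT + ν + 1)`, for `ν = 0, …, T - 1`. -/
def blockCoeff (a : ℕ → ℂ) (j : ℕ) : Fin T → ℂ := fun ν => a (j * T + (ν : ℕ) + 1)

/-- `A(e^{ix}) = ∑_{j ≥ 0} a⃗(j) e^{ijx}`. -/
def symbolA (a : ℕ → ℂ) (x : ℝ) : Fin T → ℂ := fun ν =>
  ∑' j : ℕ, (blockCoeff a j : Fin T → ℂ) ν * expi (j : ℤ) x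

/-- The mean square error `Δ(h; f)` of the linear estimate with spectral characteristic `h`, when
the spectral density is `f` and there is no noise. -/
def mse (a : ℕ → ℂ) (h : ℝ → Fin T → ℂ) (f : ℝ → Matrix (Fin T) (Fin T) ℂ) : ℝ≥0∞ :=
  weightedSq f (fun x => symbolA a x - h x)

/-- The error `Δ(f)` of the optimal linear estimate. -/
def optimalError (S : Finset ℤ) (a : ℕ → ℂ) (f : ℝ → Matrix (Fin T) (Fin T) ℂ) : ℝ≥0∞ :=
  ⨅ h ∈ L2s S f, mse a h f

/-- `h` is the spectral characteristic of the optimal linear estimate for the density `f`. -/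
def IsOptimal (S : Finset ℤ) (a : ℕ → ℂ) (f : ℝ → Matrix (Fin T) (Fin T) ℂ)
    (h : ℝ → Fin T → ℂ) : Prop :=
  h ∈ L2s S f ∧ mse a h f = optimalError S a f

/-- `f₀` is least favorable in the class `D`. -/
def IsLeastFavorable (S : Finset ℤ) (a : ℕ → ℂ) (D : Set (ℝ → Matrix (Fin T) (Fin T) ℂ))
    (f₀ : ℝ → Matrix (Fin T) (Fin T) ℂ) : Prop :=
  f₀ ∈ D ∧ ∀ f ∈ D, optimalError S a f ≤ optimalError S a f₀

/-- `H_D = ⋂_{f ∈ D} L₂ˢ(f)`. -/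
def HD (S : Finset ℤ) (D : Set (ℝ → Matrix (Fin T) (Fin T) ℂ)) : Set (ℝ → Fin T → ℂ) :=
  ⋂ f ∈ D, L2s S f

/-- `h₀` is a minimax (robust) spectral characteristic for the class `D`: it lies in `H_D`, its
worst error over `D` is attained, and it is the least worst error among all `h ∈ H_D`. -/
def IsMinimax (S : Finset ℤ) (a : ℕ → ℂ) (D : Set (ℝ → Matrix (Fin T) (Fin T) ℂ))
    (h₀ : ℝ → Fin T → ℂ) : Prop :=
  h₀ ∈ HD S D ∧ (∃ f ∈ D, ∀ g ∈ D, mse a h₀ g ≤ mse a h₀ f) ∧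
    ∀ h ∈ HD S D, (⨆ f ∈ D, mse a h₀ f) ≤ ⨆ f ∈ D, mse a h f

/-! ### The operator `B` and the formula for the spectral characteristic -/

/-- The block `B(k - j) = (1/2π) ∫ ((f(x))⁻¹)ᵀ e^{i(j-k)x} dx` of the matrix `B`. -/
def blockB (f : ℝ → Matrix (Fin T) (Fin T) ℂ) (k j : ℤ) : Matrix (Fin T) (Fin T) ℂ :=
  Matrix.of fun ν μ => (1 / (2 * Real.pi) : ℂ) *
    ∫ x, ((f x)⁻¹).transpose ν μ * expi (j - k) x ∂circleMeasure

/-- The right-hand side: `a⃗(m)` at `m ≥ 0`, and zero at the missing points. -/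
def rhs (a : ℕ → ℂ) (m : ℤ) : Fin T → ℂ := if 0 ≤ m then blockCoeff a m.toNat else 0

/-- `C(e^{ix}) = ∑_{n ∈ Γ} c(n) e^{inx}`: the partial sums of the series, in the natural order of
the index, converge to `C` in `L₂(f⁻¹)`. -/
def IsSeriesSum (S : Finset ℤ) (f : ℝ → Matrix (Fin T) (Fin T) ℂ) (c : ℤ → Fin T → ℂ)
    (C : ℝ → Fin T → ℂ) : Prop :=
  C ∈ L2 (fun x => (f x)⁻¹) ∧
    Tendsto (fun L : ℕ => weightedSq (fun x => (f x)⁻¹)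
      (fun x => C x - trigPoly (unobservedBelow S L) c x)) atTop (𝓝 0)

/-- `B c = b`: for every `k ∈ Γ` the series `∑_{j ∈ Γ} B(k - j) c(j)` converges to `b(k)`. -/
def BSolves (S : Finset ℤ) (f : ℝ → Matrix (Fin T) (Fin T) ℂ) (c b : ℤ → Fin T → ℂ) : Prop :=
  ∀ k ∈ unobserved S,
    Tendsto (fun L : ℕ => ∑ j ∈ unobservedBelow S L, Matrix.mulVec (blockB f k j) (c j))
      atTop (𝓝 (b k))

/-- The spectral characteristic `h(f)ᵀ = Aᵀ - Cᵀ f⁻¹`. -/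
def specChar (a : ℕ → ℂ) (f : ℝ → Matrix (Fin T) (Fin T) ℂ) (C : ℝ → Fin T → ℂ) :
    ℝ → Fin T → ℂ :=
  fun x => symbolA a x - Matrix.vecMul (C x) (f x)⁻¹

/-- The linear functional `f ↦ (1/2π) ∫ Cᵀ f₀⁻¹ f f₀⁻¹ conj(C) dx`. -/
def linFunctional (f₀ : ℝ → Matrix (Fin T) (Fin T) ℂ) (C : ℝ → Fin T → ℂ)
    (f : ℝ → Matrix (Fin T) (Fin T) ℂ) : ℝ≥0∞ :=
  weightedSq (fun x => (f₀ x)⁻¹ * f x * (f₀ x)⁻¹) C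

end

end MinimaxExtrapolation

/-!
Put `e = Cᵀ f₀⁻¹`, so that `h(f₀) = A - e`. The equations `B c = 𝐚` say that `e` and `A` have the
same Fourier coefficients on `Γ`, and `C` has spectrum in `Γ`. Hence `h(f₀)` is an integrable
function whose spectrum consists of observed times, while `e` is orthogonal in `L₂(f₀)` to the
observed exponentials, because its inner product with `p` is `∫ Cᵀ conj(p)`. The first fact
puts `h(f₀)` into `L₂ˢ(f)` for every `f ∈ D`; the second makes `h(f₀)` optimal for `f₀`. The rest is
the saddle point inequality: since `Δ(h(f₀); f)` is the given linear functional,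
`Δ(f) ≤ Δ(h(f₀); f) ≤ Δ(h(f₀); f₀) = Δ(f₀) ≤ Δ(h; f₀)` for all `f ∈ D` and `h ∈ L₂ˢ(f₀)`.

The substance is the passage from a condition on Fourier coefficients to membership in a closed
span, `mem_L2s_of_fourier_eq_zero`, for a matrix weight which is merely integrable; Fejér or
Poisson means of `h` need not converge in such a weight. The argument is of Smirnov type but stays
on the circle. `IsBoundedAntianalytic` is the closure of the polynomials in `e^{-ix}` under
boundedly convergent sequences; its members preserve negative spectra and the closed spans. For
square integrable `q ≥ 0` there is `K` with `Re K = q`, built by conjugating nonnegative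
trigonometric polynomials, such that `(t + K)⁻¹` is in this class for `t > 0`
(`exists_resolvent_family`). With `q² = ‖h‖ + ∑ |f_ij|` the multiplier `g = t (t + K)⁻¹` satisfies
`|g| ≤ 1` and `|g| q ≤ t`. So `g h` is square integrable, its Fourier sums `s` give `g s → g² h` in
`L₂(f)`, and `g² h → h` as `t → ∞`. This settles the case of no missing times
(`mem_L2s_empty_of_hasNegativeSpectrum`); finitely many missing frequencies are then removed by
means of an auxiliary weight that controls Fourier coefficients.
-/

namespace MinimaxExtrapolation

variable {T : ℕ}

/-! ### Exponentials and the measure on the circle -/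

lemma expi_eq (n : ℤ) (x : ℝ) : expi n x = Complex.exp ((n * x : ℝ) * Complex.I) := by
  simp only [expi]; congr 1; push_cast; ring

lemma norm_expi (n : ℤ) (x : ℝ) : ‖expi n x‖ = 1 := by
  rw [expi_eq, Complex.norm_exp_ofReal_mul_I]

lemma expi_zero (x : ℝ) : expi 0 x = 1 := by simp [expi]

lemma expi_add (m n : ℤ) (x : ℝ) : expi (m + n) x = expi m x * expi n x := by
  simp only [expi, ← Complex.exp_add]; congr 1; push_cast; ring

lemma star_expi (n : ℤ) (x : ℝ) : star (expi n x) = expi (-n) x := by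
  rw [expi_eq, expi_eq, Complex.star_def, ← Complex.exp_conj]
  congr 1
  simp

lemma expi_neg_natCast (n : ℕ) (x : ℝ) : expi (-(n : ℤ)) x = expi (-1) x ^ n := by
  simp only [expi, ← Complex.exp_nat_mul]; congr 1; push_cast; ring

lemma continuous_expi (n : ℤ) : Continuous (expi n) := by
  unfold expi; fun_prop

instance : IsFiniteMeasure circleMeasure := by
  unfold circleMeasure; infer_instance

lemma integral_expi (n : ℤ) :
    ∫ x, expi n x ∂circleMeasure = if n = 0 then 2 * (Real.pi : ℂ) else 0 := by
  have hpi : (-Real.pi) ≤ Real.pi := by linarith [Real.pi_pos]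
  rw [circleMeasure, ← intervalIntegral.integral_of_le hpi]
  split_ifs with h
  · subst h
    simp [expi_zero]; ring
  · have hc : Complex.I * (n : ℂ) ≠ 0 := mul_ne_zero Complex.I_ne_zero (by exact_mod_cast h)
    simp only [expi]
    rw [integral_exp_mul_complex hc, div_eq_zero_iff]
    left
    rw [sub_eq_zero, Complex.exp_eq_exp_iff_exists_int]
    refine ⟨n, ?_⟩
    push_cast; ring

/-! ### Quadratic forms of positive semidefinite matrices -/

/-- The quadratic form `bᵀ M conj(b)`, which is real when `M` is Hermitian. -/
noncomputable def quadForm (M : Matrix (Fin T) (Fin T) ℂ) (b : Fin T → ℂ) : ℝ :=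
  (b ⬝ᵥ Matrix.mulVec M (star b)).re

lemma quadForm_nonneg {M : Matrix (Fin T) (Fin T) ℂ} (hM : M.PosSemidef) (b : Fin T → ℂ) :
    0 ≤ quadForm M b := by
  have h := hM.dotProduct_mulVec_nonneg (star b)
  rw [star_star] at h
  exact (Complex.le_def.mp h).1

lemma dotProduct_mulVec_star_comm {M : Matrix (Fin T) (Fin T) ℂ} (hM : M.IsHermitian)
    (a b : Fin T → ℂ) :
    b ⬝ᵥ Matrix.mulVec M (star a) = star (a ⬝ᵥ Matrix.mulVec M (star b)) := by
  rw [← Matrix.star_dotProduct_star, Matrix.star_mulVec, star_star, hM.eq,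
    ← Matrix.dotProduct_mulVec]

lemma quadForm_add {M : Matrix (Fin T) (Fin T) ℂ} (hM : M.IsHermitian) (a b : Fin T → ℂ) :
    quadForm M (a + b)
      = quadForm M a + quadForm M b + 2 * (a ⬝ᵥ Matrix.mulVec M (star b)).re := by
  have h := congrArg Complex.re (dotProduct_mulVec_star_comm hM a b)
  simp only [Complex.star_def, Complex.conj_re] at h
  simp only [quadForm, star_add, Matrix.mulVec_add, dotProduct_add, add_dotProduct,
    Complex.add_re, h]
  ring

lemma quadForm_smul (M : Matrix (Fin T) (Fin T) ℂ) (c : ℂ) (b : Fin T → ℂ) :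
    quadForm M (c • b) = ‖c‖ ^ 2 * quadForm M b := by
  simp only [quadForm, star_smul, Matrix.mulVec_smul, dotProduct_smul, smul_dotProduct,
    smul_eq_mul, ← mul_assoc]
  rw [mul_comm (star c) c, Complex.star_def, Complex.mul_conj, Complex.re_ofReal_mul,
    Complex.normSq_eq_norm_sq]

lemma quadForm_neg (M : Matrix (Fin T) (Fin T) ℂ) (b : Fin T → ℂ) :
    quadForm M (-b) = quadForm M b := by
  simp [quadForm, Matrix.mulVec_neg]

lemma quadForm_add_le {M : Matrix (Fin T) (Fin T) ℂ} (hM : M.PosSemidef) (a b : Fin T → ℂ)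
    {δ : ℝ} (hδ : 0 < δ) :
    quadForm M (a + b) ≤ (1 + δ) * quadForm M a + (1 + δ⁻¹) * quadForm M b := by
  have h0 := quadForm_nonneg hM ((δ : ℂ) • a + -b)
  rw [quadForm_add hM.1, quadForm_neg, quadForm_smul] at h0
  rw [quadForm_add hM.1]
  simp only [star_neg, Matrix.mulVec_neg, dotProduct_neg, Complex.neg_re, smul_dotProduct,
    smul_eq_mul, Complex.re_ofReal_mul, Complex.norm_real, Real.norm_eq_abs, sq_abs] at h0
  have h1 := mul_nonneg (inv_nonneg.2 hδ.le) h0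
  have e : δ⁻¹ * (δ ^ 2 * quadForm M a + quadForm M b
      + 2 * -(δ * (a ⬝ᵥ Matrix.mulVec M (star b)).re))
      = δ * quadForm M a + δ⁻¹ * quadForm M b - 2 * (a ⬝ᵥ Matrix.mulVec M (star b)).re := by
    field_simp
    ring
  rw [e] at h1
  linarith

/-- Cauchy–Schwarz inequality for the form of `M`, against the `i`-th unit vector. -/
lemma norm_vecMul_sq_le {M : Matrix (Fin T) (Fin T) ℂ} (hM : M.PosSemidef) (b : Fin T → ℂ)
    (i : Fin T) : ‖Matrix.vecMul b M i‖ ^ 2 ≤ (M i i).re * quadForm M b := by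
  set z := Matrix.vecMul b M i with hz
  have key : ∀ t : ℝ, 0 ≤ (M i i).re * ‖z‖ ^ 2 * (t * t) + (2 * ‖z‖ ^ 2) * t + quadForm M b := by
    intro t
    have h0 := quadForm_nonneg hM (b + ((t : ℂ) * z) • (Pi.single i 1 : Fin T → ℂ))
    rw [quadForm_add hM.1, quadForm_smul] at h0
    have e1 : quadForm M (Pi.single i 1 : Fin T → ℂ) = (M i i).re := by
      simp [quadForm]
    have e2 : b ⬝ᵥ Matrix.mulVec M (star (((t : ℂ) * z) • (Pi.single i 1 : Fin T → ℂ)))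
        = ((t * ‖z‖ ^ 2 : ℝ) : ℂ) := by
      rw [star_smul, Matrix.mulVec_smul, dotProduct_smul, Matrix.dotProduct_mulVec]
      have : star (Pi.single i 1 : Fin T → ℂ) = Pi.single i 1 := by
        ext j; simp [Pi.single_apply, apply_ite]
      rw [this, dotProduct_single, ← hz]
      simp only [Complex.star_def, map_mul, Complex.conj_ofReal, smul_eq_mul, mul_one]
      rw [mul_assoc, mul_comm _ z, Complex.mul_conj, Complex.normSq_eq_norm_sq]
      push_cast; rfl
    rw [e1, e2, Complex.ofReal_re, norm_mul, Complex.norm_real, mul_pow, Real.norm_eq_abs,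
      sq_abs] at h0
    nlinarith [h0]
  have hd := discrim_le_zero key
  unfold discrim at hd
  by_cases hz0 : ‖z‖ = 0
  · rw [hz0]
    have h1 : 0 ≤ (M i i).re := (Complex.le_def.mp (hM.diag_nonneg (i := i))).1
    have := mul_nonneg h1 (quadForm_nonneg hM b)
    simpa using this
  · have hp : 0 < ‖z‖ ^ 2 := by positivity
    have : ‖z‖ ^ 2 * (‖z‖ ^ 2) ≤ ‖z‖ ^ 2 * ((M i i).re * quadForm M b) := by nlinarith
    exact le_of_mul_le_mul_left this hp

lemma quadForm_le (M : Matrix (Fin T) (Fin T) ℂ) (b : Fin T → ℂ) :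
    quadForm M b ≤ (∑ i, ∑ j, ‖M i j‖) * ‖b‖ ^ 2 := by
  refine (Complex.re_le_norm _).trans ?_
  simp only [dotProduct, Matrix.mulVec, Finset.mul_sum, Finset.sum_mul]
  refine (norm_sum_le _ _).trans (Finset.sum_le_sum fun i _ => ?_)
  refine (norm_sum_le _ _).trans (Finset.sum_le_sum fun j _ => ?_)
  rw [norm_mul, norm_mul, Pi.star_apply, norm_star]
  have hi := norm_le_pi_norm b i
  have hj := norm_le_pi_norm b j
  calc ‖b i‖ * (‖M i j‖ * ‖b j‖) ≤ ‖b‖ * (‖M i j‖ * ‖b‖) := by gcongr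
    _ = _ := by ring

lemma quadForm_vecMul {M : Matrix (Fin T) (Fin T) ℂ} (hM : M.IsHermitian)
    (N : Matrix (Fin T) (Fin T) ℂ) (b : Fin T → ℂ) :
    quadForm N (Matrix.vecMul b M) = quadForm (M * N * M) b := by
  unfold quadForm
  rw [Matrix.star_vecMul, hM.eq, ← Matrix.dotProduct_mulVec, Matrix.mulVec_mulVec,
    Matrix.mulVec_mulVec]

/-! ### The weighted mean square -/

/-- A measurable matrix weight which is positive semidefinite almost everywhere; unlike a
spectral density it need not be integrable. -/
structure IsWeight (w : ℝ → Matrix (Fin T) (Fin T) ℂ) : Prop where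
  meas : ∀ i j, AEMeasurable (fun x => w x i j) circleMeasure
  psd : ∀ᵐ x ∂circleMeasure, (w x).PosSemidef

lemma IsSpectralDensity.isWeight {f : ℝ → Matrix (Fin T) (Fin T) ℂ} (hf : IsSpectralDensity f) :
    IsWeight f :=
  ⟨fun i j => (hf.1 i j).aestronglyMeasurable.aemeasurable, hf.2⟩

lemma weightedSq_eq (w : ℝ → Matrix (Fin T) (Fin T) ℂ) (b : ℝ → Fin T → ℂ) :
    weightedSq w b = ENNReal.ofReal (1 / (2 * Real.pi)) *
      ∫⁻ x, ENNReal.ofReal (quadForm (w x) (b x)) ∂circleMeasure := rfl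

lemma lintegral_quadForm_eq (w : ℝ → Matrix (Fin T) (Fin T) ℂ) (b : ℝ → Fin T → ℂ) :
    ∫⁻ x, ENNReal.ofReal (quadForm (w x) (b x)) ∂circleMeasure
      = ENNReal.ofReal (2 * Real.pi) * weightedSq w b := by
  have hp : 0 < 2 * Real.pi := by positivity
  rw [weightedSq_eq, ← mul_assoc, ← ENNReal.ofReal_mul hp.le, mul_one_div_cancel hp.ne',
    ENNReal.ofReal_one, one_mul]

lemma aemeasurable_quadForm {w : ℝ → Matrix (Fin T) (Fin T) ℂ}
    (hw : ∀ i j, AEMeasurable (fun x => w x i j) circleMeasure) {b : ℝ → Fin T → ℂ}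
    (hb : AEStronglyMeasurable b circleMeasure) :
    AEMeasurable (fun x => quadForm (w x) (b x)) circleMeasure := by
  have hb' : ∀ i, AEMeasurable (fun x => b x i) circleMeasure := fun i =>
    aemeasurable_pi_iff.1 hb.aemeasurable i
  refine Complex.measurable_re.comp_aemeasurable ?_
  simp only [dotProduct, Matrix.mulVec, Pi.star_apply]
  refine Finset.aemeasurable_fun_sum _ fun i _ => (hb' i).mul ?_
  exact Finset.aemeasurable_fun_sum _ fun j _ => (hw i j).mul
    (continuous_star.measurable.comp_aemeasurable (hb' j))

lemma aestronglyMeasurable_vecMul {w : ℝ → Matrix (Fin T) (Fin T) ℂ}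
    (hw : ∀ i j, AEMeasurable (fun x => w x i j) circleMeasure) {b : ℝ → Fin T → ℂ}
    (hb : AEStronglyMeasurable b circleMeasure) :
    AEStronglyMeasurable (fun x => Matrix.vecMul (b x) (w x)) circleMeasure := by
  have hb' : ∀ i, AEMeasurable (fun x => b x i) circleMeasure := fun i =>
    aemeasurable_pi_iff.1 hb.aemeasurable i
  refine AEMeasurable.aestronglyMeasurable (aemeasurable_pi_iff.2 fun j => ?_)
  simp only [dotProduct, Matrix.vecMul]
  exact Finset.aemeasurable_fun_sum _ fun i _ => (hb' i).mul (hw i j)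

lemma weightedSq_mono {w w' : ℝ → Matrix (Fin T) (Fin T) ℂ} {b b' : ℝ → Fin T → ℂ}
    (h : ∀ᵐ x ∂circleMeasure, quadForm (w x) (b x) ≤ quadForm (w' x) (b' x)) :
    weightedSq w b ≤ weightedSq w' b' := by
  rw [weightedSq_eq, weightedSq_eq]
  refine mul_le_mul_right ?_ _
  exact lintegral_mono_ae (h.mono fun x hx => ENNReal.ofReal_le_ofReal hx)

lemma weightedSq_congr {w w' : ℝ → Matrix (Fin T) (Fin T) ℂ} {b b' : ℝ → Fin T → ℂ}
    (h : ∀ᵐ x ∂circleMeasure, quadForm (w x) (b x) = quadForm (w' x) (b' x)) :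
    weightedSq w b = weightedSq w' b' :=
  le_antisymm (weightedSq_mono (h.mono fun _ hx => hx.le))
    (weightedSq_mono (h.mono fun _ hx => hx.ge))

lemma weightedSq_sub_comm (w : ℝ → Matrix (Fin T) (Fin T) ℂ) (b b' : ℝ → Fin T → ℂ) :
    weightedSq w (fun x => b x - b' x) = weightedSq w (fun x => b' x - b x) :=
  weightedSq_congr (Eventually.of_forall fun x => by
    rw [← neg_sub (b' x) (b x), quadForm_neg])

lemma weightedSq_add_le_of_pos {w : ℝ → Matrix (Fin T) (Fin T) ℂ} (hw : IsWeight w)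
    {a b : ℝ → Fin T → ℂ} (ha : AEStronglyMeasurable a circleMeasure) {δ : ℝ} (hδ : 0 < δ) :
    weightedSq w (fun x => a x + b x)
      ≤ ENNReal.ofReal (1 + δ) * weightedSq w a + ENNReal.ofReal (1 + δ⁻¹) * weightedSq w b := by
  have hδ' : 0 < δ⁻¹ := inv_pos.2 hδ
  simp only [weightedSq_eq]
  rw [mul_left_comm (ENNReal.ofReal (1 + δ)), mul_left_comm (ENNReal.ofReal (1 + δ⁻¹)), ← mul_add]
  gcongr
  rw [← lintegral_const_mul' _ _ ENNReal.ofReal_ne_top,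
    ← lintegral_const_mul' _ _ ENNReal.ofReal_ne_top, ← lintegral_add_left']
  · refine lintegral_mono_ae (hw.psd.mono fun x hx => ?_)
    have h1 := quadForm_nonneg hx (a x)
    have h2 := quadForm_nonneg hx (b x)
    rw [← ENNReal.ofReal_mul (by positivity), ← ENNReal.ofReal_mul (by positivity),
      ← ENNReal.ofReal_add (by positivity) (by positivity)]
    exact ENNReal.ofReal_le_ofReal (quadForm_add_le hx _ _ hδ)
  · exact ((aemeasurable_quadForm hw.meas ha).ennreal_ofReal).const_mul _

lemma weightedSq_add_le {w : ℝ → Matrix (Fin T) (Fin T) ℂ} (hw : IsWeight w)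
    {a b : ℝ → Fin T → ℂ} (ha : AEStronglyMeasurable a circleMeasure) :
    weightedSq w (fun x => a x + b x) ≤ 2 * weightedSq w a + 2 * weightedSq w b := by
  have h := weightedSq_add_le_of_pos hw (b := b) ha one_pos
  norm_num at h
  exact h

lemma weightedSq_smul_le {w : ℝ → Matrix (Fin T) (Fin T) ℂ} (hw : IsWeight w)
    {g : ℝ → ℂ} {R : ℝ} (hg : ∀ᵐ x ∂circleMeasure, ‖g x‖ ≤ R) (b : ℝ → Fin T → ℂ) :
    weightedSq w (fun x => g x • b x) ≤ ENNReal.ofReal (R ^ 2) * weightedSq w b := by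
  rw [weightedSq_eq, weightedSq_eq, mul_left_comm]
  refine mul_le_mul_right ?_ _
  rw [← lintegral_const_mul' _ _ ENNReal.ofReal_ne_top]
  refine lintegral_mono_ae ?_
  filter_upwards [hw.psd, hg] with x hx hgx
  rw [← ENNReal.ofReal_mul (by positivity), quadForm_smul]
  have := quadForm_nonneg hx (b x)
  gcongr

/-- Dominated convergence for bounded scalar multipliers in `L₂(w)`. -/
lemma tendsto_weightedSq_smul {w : ℝ → Matrix (Fin T) (Fin T) ℂ} (hw : IsWeight w)
    {g : ℕ → ℝ → ℂ} (hgm : ∀ n, AEStronglyMeasurable (g n) circleMeasure) {R : ℝ}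
    (hg : ∀ n, ∀ᵐ x ∂circleMeasure, ‖g n x‖ ≤ R)
    (hlim : ∀ᵐ x ∂circleMeasure, Tendsto (fun n => g n x) atTop (𝓝 0))
    {b : ℝ → Fin T → ℂ} (hb : b ∈ L2 w) :
    Tendsto (fun n => weightedSq w (fun x => g n x • b x)) atTop (𝓝 0) := by
  have key : Tendsto (fun n => ∫⁻ x, ENNReal.ofReal (quadForm (w x) (g n x • b x)) ∂circleMeasure)
      atTop (𝓝 (∫⁻ _, 0 ∂circleMeasure)) := by
    refine tendsto_lintegral_of_dominated_convergence'
      (fun x => ENNReal.ofReal (R ^ 2) * ENNReal.ofReal (quadForm (w x) (b x))) ?_ ?_ ?_ ?_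
    · intro n
      exact (aemeasurable_quadForm hw.meas ((hgm n).smul hb.1)).ennreal_ofReal
    · intro n
      filter_upwards [hw.psd, hg n] with x hx hgx
      rw [← ENNReal.ofReal_mul (by positivity), quadForm_smul]
      have := quadForm_nonneg hx (b x)
      gcongr
    · rw [lintegral_const_mul' _ _ ENNReal.ofReal_ne_top, lintegral_quadForm_eq]
      exact ENNReal.mul_ne_top ENNReal.ofReal_ne_top
        (ENNReal.mul_ne_top ENNReal.ofReal_ne_top hb.2.ne)
    · filter_upwards [hlim] with x hx
      have h1 : Tendsto (fun n => ‖g n x‖ ^ 2 * quadForm (w x) (b x)) atTop (𝓝 0) := by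
        simpa using ((hx.norm).pow 2).mul_const (quadForm (w x) (b x))
      simpa [quadForm_smul] using ENNReal.tendsto_ofReal h1
  have := ENNReal.Tendsto.const_mul (a := ENNReal.ofReal (1 / (2 * Real.pi))) key
    (Or.inr ENNReal.ofReal_ne_top)
  simpa [weightedSq_eq] using this

lemma weightedSq_le_of_bound {f : ℝ → Matrix (Fin T) (Fin T) ℂ} (hf : IsSpectralDensity f)
    {b : ℝ → Fin T → ℂ} {R : ℝ} (hR : ∀ᵐ x ∂circleMeasure, ‖b x‖ ≤ R) :
    weightedSq f b ≤ ENNReal.ofReal (1 / (2 * Real.pi)) *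
      ENNReal.ofReal ((∫ x, ∑ i, ∑ j, ‖f x i j‖ ∂circleMeasure) * R ^ 2) := by
  have hint : Integrable (fun x => ∑ i, ∑ j, ‖f x i j‖) circleMeasure :=
    integrable_finsetSum _ fun i _ => integrable_finsetSum _ fun j _ => (hf.1 i j).norm
  rw [weightedSq_eq, ← integral_mul_const, ofReal_integral_eq_lintegral_ofReal
    (hint.mul_const _) (Eventually.of_forall fun x => by positivity)]
  refine mul_le_mul_right (lintegral_mono_ae ?_) _
  filter_upwards [hR] with x hx
  refine ENNReal.ofReal_le_ofReal ((quadForm_le _ _).trans ?_)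
  gcongr

lemma weightedSq_lt_top_of_bound {f : ℝ → Matrix (Fin T) (Fin T) ℂ} (hf : IsSpectralDensity f)
    {b : ℝ → Fin T → ℂ} {R : ℝ} (hR : ∀ᵐ x ∂circleMeasure, ‖b x‖ ≤ R) :
    weightedSq f b < ∞ :=
  (weightedSq_le_of_bound hf hR).trans_lt
    (ENNReal.mul_lt_top ENNReal.ofReal_lt_top ENNReal.ofReal_lt_top)

lemma L2_add {w : ℝ → Matrix (Fin T) (Fin T) ℂ} (hw : IsWeight w) {a b : ℝ → Fin T → ℂ}
    (ha : a ∈ L2 w) (hb : b ∈ L2 w) : (fun x => a x + b x) ∈ L2 w := by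
  refine ⟨ha.1.add hb.1, (weightedSq_add_le hw ha.1).trans_lt ?_⟩
  exact ENNReal.add_lt_top.2 ⟨ENNReal.mul_lt_top (by simp) ha.2, ENNReal.mul_lt_top (by simp) hb.2⟩

lemma L2_smul {w : ℝ → Matrix (Fin T) (Fin T) ℂ} (hw : IsWeight w) {b : ℝ → Fin T → ℂ}
    (hb : b ∈ L2 w) {g : ℝ → ℂ} (hgm : AEStronglyMeasurable g circleMeasure) {R : ℝ}
    (hg : ∀ᵐ x ∂circleMeasure, ‖g x‖ ≤ R) : (fun x => g x • b x) ∈ L2 w :=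
  ⟨hgm.smul hb.1, (weightedSq_smul_le hw hg b).trans_lt
    (ENNReal.mul_lt_top ENNReal.ofReal_lt_top hb.2)⟩

lemma L2_sub {w : ℝ → Matrix (Fin T) (Fin T) ℂ} (hw : IsWeight w) {a b : ℝ → Fin T → ℂ}
    (ha : a ∈ L2 w) (hb : b ∈ L2 w) : (fun x => a x - b x) ∈ L2 w := by
  have h := L2_add hw ha (L2_smul hw hb (g := fun _ => -1) aestronglyMeasurable_const
    (R := 1) (by simp))
  simpa [sub_eq_add_neg] using h

/-! ### Trigonometric polynomials and the spaces `L₂ˢ(f)` -/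

lemma continuous_trigPoly (F : Finset ℤ) (v : ℤ → Fin T → ℂ) : Continuous (trigPoly F v) := by
  unfold trigPoly
  exact continuous_finsetSum _ fun n _ => (continuous_expi n).smul continuous_const

lemma norm_trigPoly_le (F : Finset ℤ) (v : ℤ → Fin T → ℂ) (x : ℝ) :
    ‖trigPoly F v x‖ ≤ ∑ n ∈ F, ‖v n‖ := by
  unfold trigPoly
  refine (norm_sum_le _ _).trans (Finset.sum_le_sum fun n _ => ?_)
  rw [norm_smul, norm_expi, one_mul]

lemma trigPoly_mem_L2 {f : ℝ → Matrix (Fin T) (Fin T) ℂ} (hf : IsSpectralDensity f)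
    (F : Finset ℤ) (v : ℤ → Fin T → ℂ) : trigPoly F v ∈ L2 f :=
  ⟨(continuous_trigPoly F v).aestronglyMeasurable,
    weightedSq_lt_top_of_bound hf (Eventually.of_forall (norm_trigPoly_le F v))⟩

lemma trigPoly_apply (F : Finset ℤ) (v : ℤ → Fin T → ℂ) (x : ℝ) (i : Fin T) :
    trigPoly F v x i = ∑ n ∈ F, v n i * expi n x := by
  simp [trigPoly, Finset.sum_apply, mul_comm]

lemma trigPoly_subset {F F' : Finset ℤ} (h : F ⊆ F') (v : ℤ → Fin T → ℂ) (x : ℝ) :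
    trigPoly F v x = trigPoly F' (fun n => if n ∈ F then v n else 0) x := by
  unfold trigPoly
  rw [← Finset.sum_subset h]
  · exact Finset.sum_congr rfl fun n hn => by simp only [if_pos hn]
  · intro n _ hn
    simp only [if_neg hn, smul_zero]

lemma exists_trigPoly_add (F F' : Finset ℤ) (v v' : ℤ → Fin T → ℂ) :
    ∃ u, ∀ x, trigPoly F v x + trigPoly F' v' x = trigPoly (F ∪ F') u x := by
  refine ⟨fun n => (if n ∈ F then v n else 0) + (if n ∈ F' then v' n else 0), fun x => ?_⟩
  rw [trigPoly_subset (Finset.subset_union_left (s₂ := F')) v,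
    trigPoly_subset (Finset.subset_union_right (s₁ := F)) v']
  simp only [trigPoly, ← Finset.sum_add_distrib, smul_add]

lemma trigPoly_mem_L2s {S : Finset ℤ} {f : ℝ → Matrix (Fin T) (Fin T) ℂ}
    (hf : IsSpectralDensity f) {F : Finset ℤ} (hF : ∀ n ∈ F, n ∈ observed S)
    (v : ℤ → Fin T → ℂ) : trigPoly F v ∈ L2s S f :=
  ⟨trigPoly_mem_L2 hf F v, fun ε hε => ⟨F, v, hF, by simpa [weightedSq] using hε⟩⟩

lemma two_mul_div_four_add {ε : ℝ≥0∞} : 2 * (ε / 4) + 2 * (ε / 4) = ε := by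
  rw [← two_mul, ← mul_assoc]; norm_num
  exact ENNReal.mul_div_cancel (by norm_num) (by norm_num)

/-- A mean square `2a + 2b` of two small terms is small. -/
lemma two_mul_add_two_mul_lt {a b ε : ℝ≥0∞} (ha : a < ε / 4) (hb : b < ε / 4) :
    2 * a + 2 * b < ε := by
  calc 2 * a + 2 * b < 2 * (ε / 4) + 2 * (ε / 4) :=
        ENNReal.add_lt_add ((ENNReal.mul_lt_mul_iff_right (by simp) (by simp)).2 ha)
          ((ENNReal.mul_lt_mul_iff_right (by simp) (by simp)).2 hb)
    _ = ε := two_mul_div_four_add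

lemma L2s_add {S : Finset ℤ} {f : ℝ → Matrix (Fin T) (Fin T) ℂ}
    (hf : IsSpectralDensity f) {a b : ℝ → Fin T → ℂ} (ha : a ∈ L2s S f) (hb : b ∈ L2s S f) :
    (fun x => a x + b x) ∈ L2s S f := by
  refine ⟨L2_add hf.isWeight ha.1 hb.1, fun ε hε => ?_⟩
  have hε' : 0 < ε / 4 := ENNReal.div_pos hε.ne' (by simp)
  obtain ⟨F, v, hF, h⟩ := ha.2 _ hε'
  obtain ⟨F', v', hF', h'⟩ := hb.2 _ hε'
  obtain ⟨u, hu⟩ := exists_trigPoly_add F F' v v'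
  refine ⟨F ∪ F', u, fun n hn => (Finset.mem_union.1 hn).elim (hF n) (hF' n), ?_⟩
  have e : (fun x => a x + b x - trigPoly (F ∪ F') u x)
      = fun x => (a x - trigPoly F v x) + (b x - trigPoly F' v' x) := by
    funext x; rw [← hu]; abel
  rw [e]
  exact (weightedSq_add_le hf.isWeight
    (ha.1.1.sub (continuous_trigPoly F v).aestronglyMeasurable)).trans_lt
    (two_mul_add_two_mul_lt h h')

/-- `L₂ˢ(f)` is closed in `L₂(f)`. -/
lemma L2s_of_forall_approx {S : Finset ℤ} {f : ℝ → Matrix (Fin T) (Fin T) ℂ}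
    (hf : IsSpectralDensity f) {b : ℝ → Fin T → ℂ} (hb : b ∈ L2 f)
    (h : ∀ ε : ℝ≥0∞, 0 < ε → ∃ b' ∈ L2s S f, weightedSq f (fun x => b x - b' x) < ε) :
    b ∈ L2s S f := by
  refine ⟨hb, fun ε hε => ?_⟩
  have hε' : 0 < ε / 4 := ENNReal.div_pos hε.ne' (by simp)
  obtain ⟨b', hb', h1⟩ := h _ hε'
  obtain ⟨F, v, hF, h2⟩ := hb'.2 _ hε'
  refine ⟨F, v, hF, ?_⟩
  have e : (fun x => b x - trigPoly F v x)
      = fun x => (b x - b' x) + (b' x - trigPoly F v x) := by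
    funext x; abel
  rw [e]
  exact (weightedSq_add_le hf.isWeight (hb.1.sub hb'.1.1)).trans_lt (two_mul_add_two_mul_lt h1 h2)

/-! ### Bounded antianalytic multipliers -/

/-- The smallest class of functions on the circle which contains the constants and `e^{-ix}` and
is closed under sums, products and boundedly convergent (almost everywhere) sequences. Its members
are boundary values of bounded analytic functions of `z = e^{-ix}`. -/
inductive IsBoundedAntianalytic : (ℝ → ℂ) → Prop
  | const (c : ℂ) : IsBoundedAntianalytic fun _ => c
  | expi : IsBoundedAntianalytic (expi (-1))
  | add {g g' : ℝ → ℂ} : IsBoundedAntianalytic g → IsBoundedAntianalytic g' →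
      IsBoundedAntianalytic fun x => g x + g' x
  | mul {g g' : ℝ → ℂ} : IsBoundedAntianalytic g → IsBoundedAntianalytic g' →
      IsBoundedAntianalytic fun x => g x * g' x
  | lim {g : ℕ → ℝ → ℂ} {G : ℝ → ℂ} (R : ℝ) : (∀ n, IsBoundedAntianalytic (g n)) →
      (∀ n, ∀ᵐ x ∂circleMeasure, ‖g n x‖ ≤ R) →
      (∀ᵐ x ∂circleMeasure, Tendsto (fun n => g n x) atTop (𝓝 (G x))) →
      IsBoundedAntianalytic G

namespace IsBoundedAntianalytic

lemma aestronglyMeasurable {g : ℝ → ℂ} (hg : IsBoundedAntianalytic g) :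
    AEStronglyMeasurable g circleMeasure := by
  induction hg with
  | const c => exact aestronglyMeasurable_const
  | expi => exact (continuous_expi _).aestronglyMeasurable
  | add _ _ h h' => exact h.add h'
  | mul _ _ h h' => exact h.mul h'
  | lim R _ _ hlim h => exact aestronglyMeasurable_of_tendsto_ae atTop h hlim

lemma exists_bound {g : ℝ → ℂ} (hg : IsBoundedAntianalytic g) :
    ∃ R : ℝ, ∀ᵐ x ∂circleMeasure, ‖g x‖ ≤ R := by
  induction hg with
  | const c => exact ⟨‖c‖, by simp⟩
  | expi => exact ⟨1, by simp [norm_expi]⟩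
  | add _ _ h h' =>
    obtain ⟨R, hR⟩ := h
    obtain ⟨R', hR'⟩ := h'
    refine ⟨R + R', ?_⟩
    filter_upwards [hR, hR'] with x h1 h2
    exact (norm_add_le _ _).trans (add_le_add h1 h2)
  | mul _ _ h h' =>
    obtain ⟨R, hR⟩ := h
    obtain ⟨R', hR'⟩ := h'
    refine ⟨R * R', ?_⟩
    filter_upwards [hR, hR'] with x h1 h2
    rw [norm_mul]
    exact mul_le_mul h1 h2 (norm_nonneg _) ((norm_nonneg _).trans h1)
  | @lim g G R _ hR hlim _ =>
    refine ⟨R, ?_⟩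
    filter_upwards [ae_all_iff.2 hR, hlim] with x h1 h2
    exact le_of_tendsto h2.norm (Eventually.of_forall h1)

end IsBoundedAntianalytic

/-- An integrable function whose Fourier coefficients at `0, 1, 2, …` vanish. -/
def HasNegativeSpectrum (u : ℝ → ℂ) : Prop :=
  Integrable u circleMeasure ∧ ∀ k : ℕ, ∫ x, u x * expi (-(k : ℤ)) x ∂circleMeasure = 0

lemma integrable_mul_expi {u : ℝ → ℂ} (hu : Integrable u circleMeasure) (n : ℤ) :
    Integrable (fun x => u x * expi n x) circleMeasure :=
  hu.mul_bdd (continuous_expi n).aestronglyMeasurable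
    (Eventually.of_forall fun x => (norm_expi n x).le)

lemma IsBoundedAntianalytic.hasNegativeSpectrum_mul {g : ℝ → ℂ} (hg : IsBoundedAntianalytic g) :
    ∀ {u : ℝ → ℂ}, HasNegativeSpectrum u → HasNegativeSpectrum fun x => g x * u x := by
  induction hg with
  | const c =>
    intro u hu
    refine ⟨hu.1.const_mul c, fun k => ?_⟩
    simp only [mul_assoc]
    rw [integral_const_mul, hu.2 k, mul_zero]
  | expi =>
    intro u hu
    refine ⟨by simpa only [mul_comm] using integrable_mul_expi hu.1 (-1), fun k => ?_⟩
    rw [← hu.2 (k + 1)]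
    refine integral_congr_ae (Eventually.of_forall fun x => ?_)
    have : (-((k + 1 : ℕ) : ℤ)) = -1 + -(k : ℤ) := by push_cast; ring
    simp only [this, expi_add]
    ring
  | add _ _ h h' =>
    intro u hu
    have h1 := h hu
    have h2 := h' hu
    simp only [add_mul]
    refine ⟨h1.1.add h2.1, fun k => ?_⟩
    simp only [add_mul]
    rw [integral_add (integrable_mul_expi h1.1 _) (integrable_mul_expi h2.1 _), h1.2, h2.2,
      add_zero]
  | mul _ _ h h' =>
    intro u hu
    simpa only [mul_assoc] using h (h' hu)
  | @lim g G R hg hR hlim ih =>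
    intro u hu
    have hGR := (IsBoundedAntianalytic.lim R hg hR hlim)
    obtain ⟨R', hR'⟩ := hGR.exists_bound
    refine ⟨hu.1.bdd_mul hGR.aestronglyMeasurable hR', fun k => ?_⟩
    have ht : Tendsto (fun n => ∫ x, g n x * u x * MinimaxExtrapolation.expi (-(k : ℤ)) x
        ∂circleMeasure) atTop
        (𝓝 (∫ x, G x * u x * MinimaxExtrapolation.expi (-(k : ℤ)) x ∂circleMeasure)) := by
      refine tendsto_integral_of_dominated_convergence (fun x => R * ‖u x‖) ?_ ?_ ?_ ?_
      · exact fun n => (integrable_mul_expi (ih n hu).1 _).aestronglyMeasurable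
      · exact hu.1.norm.const_mul R
      · intro n
        filter_upwards [hR n] with x hx
        rw [norm_mul, norm_mul, norm_expi, mul_one]
        gcongr
      · filter_upwards [hlim] with x hx
        exact (hx.mul_const _).mul_const _
    exact tendsto_nhds_unique ht (by simp [(ih _ hu).2 k])

lemma mem_observed_empty {n : ℤ} : n ∈ observed ∅ ↔ n < 0 := by simp [observed]

lemma smul_mem_L2s_of_trigPoly {S : Finset ℤ} {f : ℝ → Matrix (Fin T) (Fin T) ℂ}
    (hf : IsSpectralDensity f) {g : ℝ → ℂ} (hgm : AEStronglyMeasurable g circleMeasure) {R : ℝ}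
    (hR : ∀ᵐ x ∂circleMeasure, ‖g x‖ ≤ R)
    (h : ∀ (F : Finset ℤ) (v : ℤ → Fin T → ℂ), (∀ n ∈ F, n ∈ observed S) →
      (fun x => g x • trigPoly F v x) ∈ L2s S f)
    {b : ℝ → Fin T → ℂ} (hb : b ∈ L2s S f) : (fun x => g x • b x) ∈ L2s S f := by
  refine L2s_of_forall_approx hf (L2_smul hf.isWeight hb.1 hgm hR) fun ε hε => ?_
  have hε' : 0 < ε / ENNReal.ofReal (R ^ 2) := ENNReal.div_pos hε.ne' ENNReal.ofReal_ne_top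
  obtain ⟨F, v, hF, hlt⟩ := hb.2 _ hε'
  refine ⟨_, h F v hF, ?_⟩
  simp only [← smul_sub]
  refine (weightedSq_smul_le hf.isWeight hR _).trans_lt ?_
  rw [mul_comm]
  exact ENNReal.mul_lt_of_lt_div hlt

lemma IsBoundedAntianalytic.smul_mem_L2s {f : ℝ → Matrix (Fin T) (Fin T) ℂ}
    (hf : IsSpectralDensity f) {g : ℝ → ℂ} (hg : IsBoundedAntianalytic g) :
    ∀ {b : ℝ → Fin T → ℂ}, b ∈ L2s ∅ f → (fun x => g x • b x) ∈ L2s ∅ f := by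
  induction hg with
  | const c =>
    intro b hb
    refine smul_mem_L2s_of_trigPoly hf aestronglyMeasurable_const (R := ‖c‖) (by simp)
      (fun F v hF => ?_) hb
    have e : (fun x => c • trigPoly F v x) = trigPoly F fun n => c • v n := by
      funext x
      simp only [trigPoly, Finset.smul_sum, smul_comm c]
    rw [e]
    exact trigPoly_mem_L2s hf hF _
  | expi =>
    intro b hb
    refine smul_mem_L2s_of_trigPoly hf (continuous_expi _).aestronglyMeasurable (R := 1)
      (by simp [norm_expi]) (fun F v hF => ?_) hb
    have e : (fun x => MinimaxExtrapolation.expi (-1) x • trigPoly F v x)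
        = trigPoly (F.image fun n => -1 + n) fun n => v (1 + n) := by
      funext x
      unfold trigPoly
      rw [Finset.sum_image (fun a _ b _ h => by simpa using h), Finset.smul_sum]
      refine Finset.sum_congr rfl fun n _ => ?_
      simp only [smul_smul, ← expi_add, add_neg_cancel_left]
    rw [e]
    refine trigPoly_mem_L2s hf (fun n hn => ?_) _
    obtain ⟨m, hm, rfl⟩ := Finset.mem_image.1 hn
    have := mem_observed_empty.1 (hF m hm)
    exact mem_observed_empty.2 (by omega)
  | add _ _ h h' =>
    intro b hb
    simp only [add_smul]
    exact L2s_add hf (h hb) (h' hb)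
  | mul _ _ h h' =>
    intro b hb
    simpa only [mul_smul] using h (h' hb)
  | @lim g G R hg hR hlim ih =>
    intro b hb
    have hGR := (IsBoundedAntianalytic.lim R hg hR hlim)
    obtain ⟨R', hR'⟩ := hGR.exists_bound
    refine L2s_of_forall_approx hf (L2_smul hf.isWeight hb.1 hGR.aestronglyMeasurable hR')
      fun ε hε => ?_
    have ht := tendsto_weightedSq_smul hf.isWeight (g := fun n x => G x - g n x) (R := R' + R)
      (fun n => hGR.aestronglyMeasurable.sub (hg n).aestronglyMeasurable)
      (fun n => by
        filter_upwards [hR', hR n] with x h1 h2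
        exact (norm_sub_le _ _).trans (add_le_add h1 h2))
      (by
        filter_upwards [hlim] with x hx
        simpa using hx.const_sub (G x))
      hb.1
    obtain ⟨n, hn⟩ := (ht.eventually_lt_const hε).exists
    refine ⟨_, ih n hb, ?_⟩
    simpa only [sub_smul] using hn

/-- The resolvent at `-t < 0` of a bounded antianalytic function with nonnegative real part, as a
geometric series. -/
lemma IsBoundedAntianalytic.resolvent {P : ℝ → ℂ} (hP : IsBoundedAntianalytic P)
    (hre : ∀ᵐ x ∂circleMeasure, 0 ≤ (P x).re) {t : ℝ} (ht : 0 < t) :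
    IsBoundedAntianalytic fun x => (t + P x)⁻¹ := by
  obtain ⟨R, hR⟩ := hP.exists_bound
  -- For `M` large, `t + P` takes values in the open disc with centre `M` and radius `M`.
  set M : ℝ := (t + |R|) ^ 2 / t with hM
  have hMpos : 0 < M := by positivity
  set r : ℝ → ℂ := fun x => 1 + (-((M : ℂ)⁻¹)) * (t + P x) with hr
  have hrBA : IsBoundedAntianalytic r := (const 1).add ((const _).mul ((const _).add hP))
  have hpow : ∀ k : ℕ, IsBoundedAntianalytic fun x => r x ^ k := by
    intro k
    induction k with
    | zero => simpa using const 1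
    | succ k ih => simpa only [pow_succ] using ih.mul hrBA
  have hMC : (M : ℂ) ≠ 0 := by exact_mod_cast hMpos.ne'
  have hrlt : ∀ᵐ x ∂circleMeasure, ‖r x‖ < 1 ∧ t ≤ ‖(t : ℂ) + P x‖ := by
    filter_upwards [hR, hre] with x h1 h2
    have hw : t ≤ ((t : ℂ) + P x).re := by simp; exact h2
    have hwn : ‖(t : ℂ) + P x‖ ≤ t + |R| := by
      refine (norm_add_le _ _).trans (add_le_add ?_ (h1.trans (le_abs_self R)))
      rw [Complex.norm_real, Real.norm_eq_abs, abs_of_pos ht]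
    refine ⟨?_, hw.trans (Complex.re_le_norm _)⟩
    set w : ℂ := (t : ℂ) + P x
    have hrx : r x = (M : ℂ)⁻¹ * ((M : ℂ) - w) := by
      rw [mul_sub, inv_mul_cancel₀ hMC, hr]; ring
    have hMw : ‖(M : ℂ) - w‖ < M := by
      refine lt_of_pow_lt_pow_left₀ 2 hMpos.le ?_
      have e : ‖(M : ℂ) - w‖ ^ 2 = M ^ 2 - 2 * M * w.re + ‖w‖ ^ 2 := by
        rw [← Complex.normSq_eq_norm_sq, ← Complex.normSq_eq_norm_sq, Complex.normSq_apply,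
          Complex.normSq_apply]
        simp; ring
      have e2 : M * t = (t + |R|) ^ 2 := by rw [hM]; field_simp
      have e3 : ‖w‖ ^ 2 ≤ (t + |R|) ^ 2 := by gcongr
      have e4 : M * t ≤ M * w.re := by gcongr
      have e5 : 0 < M * t := by positivity
      rw [e]; linarith
    rw [hrx, norm_mul, norm_inv, Complex.norm_real, Real.norm_eq_abs, abs_of_pos hMpos,
      inv_mul_lt_one₀ hMpos]
    exact hMw
  have hsum : ∀ k : ℕ, IsBoundedAntianalytic
      fun x => (M : ℂ)⁻¹ * ∑ j ∈ Finset.range k, r x ^ j := by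
    intro k
    refine (const _).mul ?_
    induction k with
    | zero => simpa using const 0
    | succ k ih => simpa only [Finset.sum_range_succ] using ih.add (hpow k)
  have hform : ∀ (k : ℕ) (x : ℝ), t ≤ ‖(t : ℂ) + P x‖ →
      (M : ℂ)⁻¹ * ∑ j ∈ Finset.range k, r x ^ j = (1 - r x ^ k) * ((t : ℂ) + P x)⁻¹ := by
    intro k x hx
    have hw0 : (t : ℂ) + P x ≠ 0 := norm_pos_iff.1 (ht.trans_le hx)
    have h1 : (1 - r x) = (M : ℂ)⁻¹ * (t + P x) := by rw [hr]; ring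
    have h2 := mul_neg_geom_sum (r x) k
    rw [h1] at h2
    rw [← h2]
    field_simp
  refine IsBoundedAntianalytic.lim (2 * t⁻¹) hsum (fun k => ?_) ?_
  · filter_upwards [hrlt] with x ⟨h1, h2⟩
    rw [hform k x h2, norm_mul, norm_inv]
    have h3 : ‖1 - r x ^ k‖ ≤ 2 := by
      refine (norm_sub_le _ _).trans ?_
      rw [norm_one, norm_pow]
      have := pow_le_one₀ (norm_nonneg (r x)) h1.le (n := k)
      linarith
    gcongr
  · filter_upwards [hrlt] with x ⟨h1, h2⟩
    simp only [hform _ x h2]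
    simpa using ((tendsto_pow_atTop_nhds_zero_of_norm_lt_one h1).const_sub 1).mul_const
      ((t : ℂ) + P x)⁻¹

/-! ### Transfer from the additive circle -/

instance : Fact (0 < 2 * Real.pi) := ⟨Real.two_pi_pos⟩

/-- The extension to the additive circle of the restriction of `u` to `(-π, π]`. -/
noncomputable def toCircle (u : ℝ → ℂ) : AddCircle (2 * Real.pi) → ℂ :=
  AddCircle.liftIoc (2 * Real.pi) (-Real.pi) u

lemma circleMeasure_eq :
    circleMeasure = volume.restrict (Set.Ioc (-Real.pi) (-Real.pi + 2 * Real.pi)) := by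
  rw [circleMeasure]; congr 2; ring

lemma measurePreserving_coe_circle :
    MeasurePreserving (fun x : ℝ => (x : AddCircle (2 * Real.pi))) circleMeasure volume := by
  rw [circleMeasure_eq]
  exact AddCircle.measurePreserving_mk (2 * Real.pi) (-Real.pi)

lemma toCircle_coe (u : ℝ → ℂ) :
    ∀ᵐ (x : ℝ) ∂circleMeasure, toCircle u (x : AddCircle (2 * Real.pi)) = u x := by
  rw [circleMeasure_eq]
  filter_upwards [ae_restrict_mem measurableSet_Ioc] with x hx
  exact AddCircle.liftIoc_coe_apply hx

lemma memLp_toCircle {u : ℝ → ℂ} {p : ℝ≥0∞} (hu : MemLp u p circleMeasure) :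
    MemLp (toCircle u) p volume := by
  rw [circleMeasure_eq] at hu
  exact hu.memLp_liftIoc

lemma fourier_coe_eq_expi {L : ℝ} (hL : L = 2 * Real.pi) (n : ℤ) (x : ℝ) :
    fourier n (x : AddCircle L) = expi n x := by
  rw [fourier_coe_apply, expi, hL]
  congr 1
  have : (Real.pi : ℂ) ≠ 0 := by exact_mod_cast Real.pi_ne_zero
  push_cast
  field_simp

lemma eLpNorm_sub_toCircle {u : ℝ → ℂ} {p : ℝ≥0∞} (hu : MemLp u p circleMeasure)
    {g : AddCircle (2 * Real.pi) → ℂ} (hg : AEStronglyMeasurable g volume) :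
    eLpNorm (fun x : ℝ => u x - g x) p circleMeasure = eLpNorm (toCircle u - g) p volume := by
  rw [← eLpNorm_comp_measurePreserving ((memLp_toCircle hu).1.sub hg) measurePreserving_coe_circle]
  refine eLpNorm_congr_ae ?_
  filter_upwards [toCircle_coe u] with x hx
  simp [hx]

/-! ### Antianalytic polynomials and the conjugate function -/

lemma continuous_eval_expi (P : Polynomial ℂ) : Continuous fun x => P.eval (expi (-1) x) :=
  P.continuous.comp (continuous_expi _)

lemma isBoundedAntianalytic_eval (P : Polynomial ℂ) :
    IsBoundedAntianalytic fun x => P.eval (expi (-1) x) := by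
  induction P using Polynomial.induction_on' with
  | add p q hp hq => simpa only [Polynomial.eval_add] using hp.add hq
  | monomial n c =>
    simp only [Polynomial.eval_monomial]
    refine (IsBoundedAntianalytic.const c).mul ?_
    induction n with
    | zero => simpa using IsBoundedAntianalytic.const 1
    | succ n ih => simpa only [pow_succ] using ih.mul .expi

lemma norm_eval_expi_le (P : Polynomial ℂ) : ∃ R : ℝ, ∀ x, ‖P.eval (expi (-1) x)‖ ≤ R := by
  refine ⟨∑ k ∈ Finset.range (P.natDegree + 1), ‖P.coeff k‖, fun x => ?_⟩
  rw [Polynomial.eval_eq_sum_range]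
  refine (norm_sum_le _ _).trans (Finset.sum_le_sum fun k _ => ?_)
  rw [norm_mul, norm_pow, norm_expi, one_pow, mul_one]

lemma integrable_of_continuous_of_bound {E : Type*} [NormedAddCommGroup E] {u : ℝ → E}
    (hu : Continuous u) {R : ℝ} (hR : ∀ x, ‖u x‖ ≤ R) : Integrable u circleMeasure :=
  Integrable.of_bound hu.aestronglyMeasurable R (Eventually.of_forall hR)

lemma integral_eval_expi (P : Polynomial ℂ) :
    ∫ x, P.eval (expi (-1) x) ∂circleMeasure = 2 * (Real.pi : ℂ) * P.coeff 0 := by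
  induction P using Polynomial.induction_on' with
  | add p q hp hq =>
    obtain ⟨R, hR⟩ := norm_eval_expi_le p
    obtain ⟨R', hR'⟩ := norm_eval_expi_le q
    simp only [Polynomial.eval_add, Polynomial.coeff_add]
    rw [integral_add (integrable_of_continuous_of_bound (continuous_eval_expi p) hR)
      (integrable_of_continuous_of_bound (continuous_eval_expi q) hR'), hp, hq, mul_add]
  | monomial n c =>
    simp only [Polynomial.eval_monomial, ← expi_neg_natCast]
    rw [integral_const_mul, integral_expi, Polynomial.coeff_monomial]
    simp [mul_comm]

/-- The conjugate function has at most the mean square of the function: `∫ P² = 2π P̂(0)² ≥ 0`. -/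
lemma integral_im_sq_le (P : Polynomial ℂ) (h0 : (P.coeff 0).im = 0) :
    ∫ x, (P.eval (expi (-1) x)).im ^ 2 ∂circleMeasure
      ≤ ∫ x, (P.eval (expi (-1) x)).re ^ 2 ∂circleMeasure := by
  obtain ⟨R, hR⟩ := norm_eval_expi_le P
  have hc := continuous_eval_expi P
  have hre : Integrable (fun x => (P.eval (expi (-1) x)).re ^ 2) circleMeasure := by
    refine integrable_of_continuous_of_bound ((Complex.continuous_re.comp hc).pow 2) (R := R ^ 2)
      fun x => ?_
    rw [norm_pow]
    have := (Complex.abs_re_le_norm _).trans (hR x)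
    gcongr
    exact this
  have him : Integrable (fun x => (P.eval (expi (-1) x)).im ^ 2) circleMeasure := by
    refine integrable_of_continuous_of_bound ((Complex.continuous_im.comp hc).pow 2) (R := R ^ 2)
      fun x => ?_
    rw [norm_pow]
    have := (Complex.abs_im_le_norm _).trans (hR x)
    gcongr
    exact this
  obtain ⟨R', hR'⟩ := norm_eval_expi_le (P ^ 2)
  have hint := integrable_of_continuous_of_bound (continuous_eval_expi (P ^ 2)) hR'
  have h1 := congrArg Complex.re (integral_eval_expi (P ^ 2))
  have hswap : (∫ x, (P ^ 2).eval (expi (-1) x) ∂circleMeasure).re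
      = ∫ x, ((P ^ 2).eval (expi (-1) x)).re ∂circleMeasure :=
    (integral_re hint).symm
  rw [hswap] at h1
  have h2 : ∫ x, ((P ^ 2).eval (expi (-1) x)).re ∂circleMeasure
      = ∫ x, (P.eval (expi (-1) x)).re ^ 2 ∂circleMeasure
        - ∫ x, (P.eval (expi (-1) x)).im ^ 2 ∂circleMeasure := by
    rw [← integral_sub hre him]
    refine integral_congr_ae (Eventually.of_forall fun x => ?_)
    simp [pow_two]
  have h3 : 0 ≤ (2 * (Real.pi : ℂ) * (P ^ 2).coeff 0).re := by
    have hr : P.coeff 0 = ((P.coeff 0).re : ℂ) := by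
      apply Complex.ext <;> simp [h0]
    have e : (2 * (Real.pi : ℂ) * (P ^ 2).coeff 0)
        = ((2 * Real.pi * (P.coeff 0).re ^ 2 : ℝ) : ℂ) := by
      rw [pow_two, Polynomial.mul_coeff_zero, hr]
      push_cast
      simp only [Complex.ofReal_re]
      ring
    rw [e, Complex.ofReal_re]
    positivity
  linarith

lemma eLpNorm_eval_expi_le (P : Polynomial ℂ) (h0 : (P.coeff 0).im = 0) :
    eLpNorm (fun x => P.eval (expi (-1) x)) 2 circleMeasure
      ≤ 2 * eLpNorm (fun x => (P.eval (expi (-1) x)).re) 2 circleMeasure := by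
  obtain ⟨R, hR⟩ := norm_eval_expi_le P
  have hc := continuous_eval_expi P
  have hcre := Complex.continuous_re.comp hc
  have hcim := Complex.continuous_im.comp hc
  have mre : MemLp (fun x => (P.eval (expi (-1) x)).re) 2 circleMeasure :=
    MemLp.of_bound hcre.aestronglyMeasurable R
      (Eventually.of_forall fun x => (Complex.abs_re_le_norm _).trans (hR x))
  have mim : MemLp (fun x => (P.eval (expi (-1) x)).im) 2 circleMeasure :=
    MemLp.of_bound hcim.aestronglyMeasurable R
      (Eventually.of_forall fun x => (Complex.abs_im_le_norm _).trans (hR x))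
  have himre : eLpNorm (fun x => (P.eval (expi (-1) x)).im) 2 circleMeasure
      ≤ eLpNorm (fun x => (P.eval (expi (-1) x)).re) 2 circleMeasure := by
    rw [mre.eLpNorm_eq_integral_rpow_norm (by simp) (by simp),
      mim.eLpNorm_eq_integral_rpow_norm (by simp) (by simp)]
    refine ENNReal.ofReal_le_ofReal (Real.rpow_le_rpow ?_ ?_ (by simp))
    · exact integral_nonneg fun x => by positivity
    · simpa using integral_im_sq_le P h0
  have e : (fun x => P.eval (expi (-1) x)) = (fun x => ((P.eval (expi (-1) x)).re : ℂ))
      + fun x => ((P.eval (expi (-1) x)).im : ℂ) * Complex.I := by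
    funext x
    exact (Complex.re_add_im _).symm
  rw [e]
  refine (eLpNorm_add_le (Complex.continuous_ofReal.comp hcre).aestronglyMeasurable
    ((Complex.continuous_ofReal.comp hcim).mul continuous_const).aestronglyMeasurable
    one_le_two).trans ?_
  rw [two_mul]
  refine add_le_add (le_of_eq ?_) (le_trans (le_of_eq ?_) himre)
  · exact eLpNorm_congr_norm_ae (Eventually.of_forall fun x => by simp)
  · exact eLpNorm_congr_norm_ae (Eventually.of_forall fun x => by simp)

/-- Every trigonometric polynomial has the real part of a polynomial in `e^{-ix}`: reflect the
terms with positive frequency. The scalar `c` makes the claim stable under complex scaling. -/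
lemma exists_polynomial_re_eq {p : C(AddCircle (2 * Real.pi), ℂ)}
    (hp : p ∈ Submodule.span ℂ (Set.range (@fourier (2 * Real.pi)))) :
    ∀ c : ℂ, ∃ P : Polynomial ℂ, (P.coeff 0).im = 0 ∧
      ∀ x : ℝ, (P.eval (expi (-1) x)).re = (c * p x).re := by
  induction hp using Submodule.span_induction with
  | mem p hp =>
    obtain ⟨n, rfl⟩ := hp
    intro c
    rcases lt_trichotomy n 0 with hn | rfl | hn
    · refine ⟨Polynomial.monomial n.natAbs c, ?_, fun x => ?_⟩
      · rw [Polynomial.coeff_monomial, if_neg (by omega), Complex.zero_im]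
      · rw [Polynomial.eval_monomial, fourier_coe_eq_expi rfl, ← expi_neg_natCast]
        congr 3; omega
    · refine ⟨Polynomial.C (c.re : ℂ), by simp, fun x => ?_⟩
      rw [Polynomial.eval_C, fourier_coe_eq_expi rfl, expi_zero, mul_one, Complex.ofReal_re]
    · refine ⟨Polynomial.monomial n.natAbs (star c), ?_, fun x => ?_⟩
      · rw [Polynomial.coeff_monomial, if_neg (by omega), Complex.zero_im]
      · rw [Polynomial.eval_monomial, fourier_coe_eq_expi rfl, ← expi_neg_natCast]
        have : (-(n.natAbs : ℤ)) = -n := by omega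
        rw [this, ← star_expi, ← star_mul', Complex.star_def, Complex.conj_re]
  | zero => exact fun c => ⟨0, by simp⟩
  | add p q _ _ hp hq =>
    intro c
    obtain ⟨P, hP, hP'⟩ := hp c
    obtain ⟨Q, hQ, hQ'⟩ := hq c
    exact ⟨P + Q, by simp [hP, hQ], fun x => by simp [hP', hQ', mul_add]⟩
  | smul a p _ hp =>
    intro c
    obtain ⟨P, hP, hP'⟩ := hp (c * a)
    exact ⟨P, hP, fun x => by rw [hP']; simp [mul_assoc]⟩

/-- In mean square, a nonnegative function is approximated by nonnegative real parts of polynomials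
in `e^{-ix}`: approximate it by `|g|` with `g` continuous, and `|g|` uniformly from above. -/
lemma exists_polynomial_re_approx {q : ℝ → ℝ} (hq : MemLp q 2 circleMeasure) (hq0 : ∀ x, 0 ≤ q x)
    {ε : ℝ≥0∞} (hε : 0 < ε) :
    ∃ P : Polynomial ℂ, (P.coeff 0).im = 0 ∧ (∀ x, 0 ≤ (P.eval (expi (-1) x)).re) ∧
      eLpNorm (fun x => (P.eval (expi (-1) x)).re - q x) 2 circleMeasure ≤ ε := by
  have hqC : MemLp (fun x => (q x : ℂ)) 2 circleMeasure := hq.ofReal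
  have hε2 : ε / 2 ≠ 0 := (ENNReal.half_pos hε.ne').ne'
  obtain ⟨g, hg, hgm⟩ :=
    (memLp_toCircle hqC).exists_boundedContinuous_eLpNorm_sub_le (by simp) hε2
  obtain ⟨η, hη, hηε⟩ : ∃ η : ℝ, 0 < η ∧
      circleMeasure Set.univ ^ (2 : ℝ≥0∞).toReal⁻¹ * ENNReal.ofReal (2 * η) ≤ ε / 2 := by
    have ht : Tendsto (fun η : ℝ => circleMeasure Set.univ ^ (2 : ℝ≥0∞).toReal⁻¹ *
        ENNReal.ofReal (2 * η)) (𝓝[>] 0) (𝓝 0) := by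
      have h1 : Tendsto (fun η : ℝ => ENNReal.ofReal (2 * η)) (𝓝[>] 0) (𝓝 0) := by
        have : Tendsto (fun η : ℝ => 2 * η) (𝓝[>] 0) (𝓝 0) := by
          have h := (continuous_const_mul (2 : ℝ)).tendsto 0
          rw [mul_zero] at h
          exact h.mono_left nhdsWithin_le_nhds
        simpa using ENNReal.tendsto_ofReal this
      have hne : circleMeasure Set.univ ^ (2 : ℝ≥0∞).toReal⁻¹ ≠ ∞ :=
        ENNReal.rpow_ne_top_of_nonneg (by simp) (measure_ne_top _ _)
      simpa using ENNReal.Tendsto.const_mul h1 (Or.inr hne)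
    obtain ⟨η, h1, h2⟩ := ((ht.eventually_le_const (pos_iff_ne_zero.2 hε2)).and
      self_mem_nhdsWithin).exists
    exact ⟨η, h2, h1⟩
  let ψ : C(AddCircle (2 * Real.pi), ℂ) :=
    ⟨fun y => (‖g y‖ : ℂ), Complex.continuous_ofReal.comp g.continuous.norm⟩
  have hψ : ψ ∈ (Submodule.span ℂ (Set.range (@fourier (2 * Real.pi)))).topologicalClosure := by
    rw [span_fourier_closure_eq_top]; trivial
  obtain ⟨p, hp, hpψ⟩ := Metric.mem_closure_iff.1 hψ η hη
  have hone : (fourier 0 : C(AddCircle (2 * Real.pi), ℂ))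
      ∈ Submodule.span ℂ (Set.range (@fourier (2 * Real.pi))) :=
    Submodule.subset_span ⟨0, rfl⟩
  -- Adding the constant `η` makes the real part of `p` nonnegative.
  obtain ⟨P, hP0, hP⟩ := exists_polynomial_re_eq
    (Submodule.add_mem _ hp (Submodule.smul_mem _ (η : ℂ) hone)) 1
  have hPx : ∀ x : ℝ, (P.eval (expi (-1) x)).re = (p x).re + η := by
    intro x
    rw [hP x, one_mul, ContinuousMap.add_apply, ContinuousMap.smul_apply, fourier_zero]
    simp
  have hclose : ∀ x : ℝ, |(p x).re - ‖g x‖| ≤ η := by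
    intro x
    have h1 := (ContinuousMap.dist_apply_le_dist (f := ψ) (g := p)
      (x : AddCircle (2 * Real.pi))).trans hpψ.le
    rw [dist_comm, dist_eq_norm] at h1
    have h2 := (Complex.abs_re_le_norm _).trans h1
    simpa [ψ] using h2
  refine ⟨P, hP0, fun x => ?_, ?_⟩
  · rw [hPx]
    have := (abs_le.1 (hclose x)).1
    have := norm_nonneg (g x)
    linarith
  · have e : (fun x => (P.eval (expi (-1) x)).re - q x)
        = (fun x => (P.eval (expi (-1) x)).re - ‖g x‖) + fun x : ℝ => ‖g x‖ - q x := by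
      funext x; simp
    have hgc : Continuous fun x : ℝ => ‖g x‖ :=
      (g.continuous.comp (AddCircle.continuous_mk' _)).norm
    have hrec := (Complex.continuous_re.comp (continuous_eval_expi P))
    rw [e, ← ENNReal.add_halves ε]
    refine (eLpNorm_add_le (hrec.sub hgc).aestronglyMeasurable
      (hgc.aestronglyMeasurable.sub hq.1) one_le_two).trans (add_le_add ?_ ?_)
    · refine (eLpNorm_le_of_ae_bound (C := 2 * η) (Eventually.of_forall fun x => ?_)).trans hηε
      change |(P.eval (expi (-1) x)).re - ‖g x‖| ≤ 2 * η
      rw [hPx]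
      have := abs_le.1 (hclose x)
      exact abs_le.2 ⟨by linarith, by linarith⟩
    · rw [← eLpNorm_sub_toCircle hqC hgm.1] at hg
      refine (eLpNorm_mono fun x => ?_).trans hg
      have h1 := abs_norm_sub_norm_le (g x) (q x : ℂ)
      rw [Complex.norm_real, Real.norm_eq_abs, abs_of_nonneg (hq0 x), norm_sub_rev] at h1
      exact h1

/-- A nonnegative square integrable `q` is the real part of a function `K` (its conjugate function
being the imaginary part) whose resolvents are bounded and antianalytic. -/
lemma exists_resolvent_family {q : ℝ → ℝ} (hq : MemLp q 2 circleMeasure) (hq0 : ∀ x, 0 ≤ q x) :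
    ∃ K : ℝ → ℂ, (∀ᵐ x ∂circleMeasure, (K x).re = q x) ∧
      ∀ t : ℝ, 0 < t → IsBoundedAntianalytic fun x => (t + K x)⁻¹ := by
  have hpos : ∀ n : ℕ, 0 < (1 / 2 : ℝ≥0∞) ^ n := fun n =>
    ENNReal.pow_pos (by simp) n
  choose P hP0 hPre hPq using fun n => exists_polynomial_re_approx hq hq0 (hpos n)
  set k : ℕ → ℝ → ℂ := fun n x => (P n).eval (expi (-1) x) with hk
  have hkm : ∀ n, AEStronglyMeasurable (k n) circleMeasure := fun n =>
    (continuous_eval_expi (P n)).aestronglyMeasurable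
  have hrem : ∀ n, AEStronglyMeasurable (fun x => (k n x).re) circleMeasure := fun n =>
    (Complex.continuous_re.comp (continuous_eval_expi (P n))).aestronglyMeasurable
  -- Conjugation is bounded, so rapid convergence of the real parts carries over to `k n`.
  have hcau : ∀ N n m : ℕ, N ≤ n → N ≤ m →
      eLpNorm (k n - k m) 2 circleMeasure < 5 * (1 / 2 : ℝ≥0∞) ^ N := by
    intro N n m hn hm
    have e : k n - k m = fun x => (P n - P m).eval (expi (-1) x) := by
      funext x; simp [hk]
    have h1 := eLpNorm_eval_expi_le (P n - P m) (by simp [hP0])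
    have h2 : eLpNorm (fun x => ((P n - P m).eval (expi (-1) x)).re) 2 circleMeasure
        ≤ (1 / 2 : ℝ≥0∞) ^ N + (1 / 2 : ℝ≥0∞) ^ N := by
      have e2 : (fun x => ((P n - P m).eval (expi (-1) x)).re)
          = (fun x => (k n x).re - q x) - fun x => (k m x).re - q x := by
        funext x; simp [hk]
      rw [e2]
      refine (eLpNorm_sub_le ((hrem n).sub hq.1) ((hrem m).sub hq.1) one_le_two).trans ?_
      exact add_le_add ((hPq n).trans (pow_le_pow_right_of_le_one' (by simp) hn))
        ((hPq m).trans (pow_le_pow_right_of_le_one' (by simp) hm))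
    rw [e]
    calc _ ≤ 2 * ((1 / 2 : ℝ≥0∞) ^ N + (1 / 2 : ℝ≥0∞) ^ N) := h1.trans (by gcongr)
      _ = 4 * (1 / 2 : ℝ≥0∞) ^ N := by rw [← two_mul, ← mul_assoc]; norm_num
      _ < 5 * (1 / 2 : ℝ≥0∞) ^ N := by
        refine (ENNReal.mul_lt_mul_iff_left (hpos N).ne' ?_).2 (by norm_num)
        exact ENNReal.pow_ne_top (by simp)
  have hsum : ∑' N : ℕ, 5 * (1 / 2 : ℝ≥0∞) ^ N ≠ ∞ := by
    rw [ENNReal.tsum_mul_left, ENNReal.tsum_geometric]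
    refine ENNReal.mul_ne_top (by simp) ?_
    simp
  have hlim := Lp.ae_tendsto_of_cauchy_eLpNorm hkm one_le_two hsum hcau
  have hex : ∀ x, ∃ l, (∃ l', Tendsto (fun n => k n x) atTop (𝓝 l')) →
      Tendsto (fun n => k n x) atTop (𝓝 l) := by
    intro x
    by_cases h : ∃ l', Tendsto (fun n => k n x) atTop (𝓝 l')
    · exact ⟨h.choose, fun _ => h.choose_spec⟩
    · exact ⟨0, fun h' => absurd h' h⟩
  choose K hK using hex
  have hKlim : ∀ᵐ x ∂circleMeasure, Tendsto (fun n => k n x) atTop (𝓝 (K x)) :=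
    hlim.mono fun x hx => hK x hx
  have hKre : ∀ᵐ x ∂circleMeasure, (K x).re = q x := by
    have hm : TendstoInMeasure circleMeasure (fun n x => (k n x).re) atTop q := by
      refine tendstoInMeasure_of_tendsto_eLpNorm (p := 2) (by simp) hrem hq.1 ?_
      refine tendsto_of_tendsto_of_tendsto_of_le_of_le tendsto_const_nhds
        (ENNReal.tendsto_pow_atTop_nhds_zero_of_lt_one (r := 1 / 2) (by simp)) (fun _ => zero_le)
        (fun n => hPq n)
    obtain ⟨ns, hns, hae⟩ := hm.exists_seq_tendsto_ae
    filter_upwards [hKlim, hae] with x h1 h2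
    exact tendsto_nhds_unique
      (((Complex.continuous_re.tendsto _).comp h1).comp hns.tendsto_atTop) h2
  refine ⟨K, hKre, fun t ht => ?_⟩
  refine IsBoundedAntianalytic.lim t⁻¹ (fun n => ((isBoundedAntianalytic_eval (P n)).resolvent
    (Eventually.of_forall (hPre n)) ht)) (fun n => Eventually.of_forall fun x => ?_) ?_
  · rw [norm_inv]
    refine inv_anti₀ ht (le_trans ?_ (Complex.re_le_norm _))
    have := hPre n x
    simp; exact this
  · filter_upwards [hKlim, hKre] with x h1 h2
    refine (h1.const_add (t : ℂ)).inv₀ fun h0 => ?_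
    have := congrArg Complex.re h0
    simp [h2] at this
    linarith [hq0 x]

/-! ### Square integrable functions with negative spectrum -/

lemma fourierCoeff_toCircle_eq_zero {u : ℝ → ℂ} (hu : HasNegativeSpectrum u) {n : ℤ}
    (hn : 0 ≤ n) : fourierCoeff (toCircle u) n = 0 := by
  obtain ⟨k, rfl⟩ := Int.eq_ofNat_of_zero_le hn
  rw [toCircle, fourierCoeff_liftIoc_eq, fourierCoeffOn_eq_integral, smul_eq_zero]
  right
  have hpi : -Real.pi ≤ -Real.pi + 2 * Real.pi := by linarith [Real.pi_pos]
  rw [intervalIntegral.integral_of_le hpi, ← circleMeasure_eq, ← hu.2 k]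
  refine integral_congr_ae (Eventually.of_forall fun x => ?_)
  have : -Real.pi + 2 * Real.pi - -Real.pi = 2 * Real.pi := by ring
  simp only [smul_eq_mul]
  rw [fourier_coe_eq_expi this, mul_comm]

/-- The partial sums of the Fourier series converge in mean square; the coefficients at
nonnegative frequencies are absent. -/
lemma exists_forall_superset_eLpNorm_lt {u : ℝ → ℂ} (hu : HasNegativeSpectrum u)
    (hu2 : MemLp u 2 circleMeasure) {ε : ℝ≥0∞} (hε : 0 < ε) :
    ∃ F₀ : Finset ℤ, ∀ F, F₀ ⊆ F →
      eLpNorm (fun x => u x - ∑ n ∈ F with n < 0, fourierCoeff (toCircle u) n * expi n x)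
        2 circleMeasure < ε := by
  have hU := memLp_toCircle hu2
  set U := hU.haarAddCircle.toLp with hUdef
  have hUc : ∀ n, fourierCoeff U n = fourierCoeff (toCircle u) n := fun n =>
    integral_congr_ae (by
      filter_upwards [hU.haarAddCircle.coeFn_toLp] with x hx
      rw [hx])
  set ψ : Finset ℤ → C(AddCircle (2 * Real.pi), ℂ) := fun F =>
    ∑ n ∈ F, fourierCoeff (toCircle u) n • fourier n with hψ
  have hs : Tendsto (fun F => ContinuousMap.toLp (E := ℂ) 2 AddCircle.haarAddCircle ℂ (ψ F)) atTop
      (𝓝 U) := by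
    have h := hasSum_fourier_series_L2 U
    simp only [hUc] at h
    simp only [HasSum, SummationFilter.unconditional_filter] at h
    simpa only [hψ, map_sum, map_smul] using h
  have hs' : Tendsto (fun F => ENNReal.ofReal (2 * Real.pi) ^ (1 / 2 : ℝ) *
      ‖U - ContinuousMap.toLp (E := ℂ) 2 AddCircle.haarAddCircle ℂ (ψ F)‖ₑ) atTop (𝓝 0) := by
    have h := (hs.const_sub U).enorm
    rw [sub_self, enorm_zero] at h
    have hne : ENNReal.ofReal (2 * Real.pi) ^ (1 / 2 : ℝ) ≠ ∞ :=
      ENNReal.rpow_ne_top_of_nonneg (by norm_num) ENNReal.ofReal_ne_top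
    simpa using ENNReal.Tendsto.const_mul h (Or.inr hne)
  obtain ⟨F₀, hF₀⟩ := eventually_atTop.1 (hs'.eventually_lt_const hε)
  refine ⟨F₀, fun F hF => lt_of_eq_of_lt ?_ (hF₀ F hF)⟩
  have e1 : (fun x => u x - ∑ n ∈ F with n < 0, fourierCoeff (toCircle u) n * expi n x)
      = fun x : ℝ => u x - ψ F x := by
    funext x
    congr 1
    simp only [hψ, ContinuousMap.coe_sum, ContinuousMap.coe_smul, Finset.sum_apply, Pi.smul_apply,
      fourier_coe_eq_expi rfl, smul_eq_mul]
    refine Finset.sum_filter_of_ne fun n _ hn => ?_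
    by_contra hn0
    exact hn (by rw [fourierCoeff_toCircle_eq_zero hu (not_lt.1 hn0), zero_mul])
  rw [e1, eLpNorm_sub_toCircle hu2 (ψ F).continuous.aestronglyMeasurable,
    AddCircle.volume_eq_smul_haarAddCircle, eLpNorm_smul_measure_of_ne_top (by simp), Lp.enorm_def]
  simp only [smul_eq_mul, ENNReal.toReal_ofNat, ENNReal.toReal_div, ENNReal.toReal_one]
  congr 1
  refine eLpNorm_congr_ae ?_
  filter_upwards [Lp.coeFn_sub U (ContinuousMap.toLp (E := ℂ) 2 AddCircle.haarAddCircle ℂ (ψ F)),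
    hU.haarAddCircle.coeFn_toLp, ContinuousMap.coeFn_toLp (p := 2) (𝕜 := ℂ)
      AddCircle.haarAddCircle (ψ F)] with x h1 h2 h3
  rw [h1, Pi.sub_apply, Pi.sub_apply, h3, hUdef, h2]

/-- In `L²`, a vector function with negative spectrum is a limit of trigonometric polynomials with
negative frequencies. -/
lemma exists_trigPoly_lintegral_sq_lt {u : ℝ → Fin T → ℂ}
    (hu : ∀ i, HasNegativeSpectrum fun x => u x i)
    (hu2 : ∀ i, MemLp (fun x => u x i) 2 circleMeasure) {ε : ℝ≥0∞} (hε : 0 < ε) :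
    ∃ (F : Finset ℤ) (v : ℤ → Fin T → ℂ), (∀ n ∈ F, n < 0) ∧
      ∀ i, ∫⁻ x, ‖u x i - trigPoly F v x i‖ₑ ^ 2 ∂circleMeasure < ε := by
  have hε' : 0 < ε ^ (1 / 2 : ℝ) := by
    refine pos_iff_ne_zero.2 fun h => ?_
    rw [ENNReal.rpow_eq_zero_iff] at h
    rcases h with h | h
    · exact hε.ne' h.1
    · norm_num at h
  choose F₀ hF₀ using fun i => exists_forall_superset_eLpNorm_lt (hu i) (hu2 i) hε'
  refine ⟨(Finset.univ.biUnion F₀).filter (· < 0),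
    fun n i => fourierCoeff (toCircle fun x => u x i) n, fun n hn => (Finset.mem_filter.1 hn).2,
    fun i => ?_⟩
  have h := hF₀ i _ (Finset.subset_biUnion_of_mem F₀ (Finset.mem_univ i))
  have h2 := eLpNorm_nnreal_pow_eq_lintegral (μ := circleMeasure) (p := 2) (by simp)
    (f := fun x => u x i - ∑ n ∈ (Finset.univ.biUnion F₀) with n < 0,
      fourierCoeff (toCircle fun x => u x i) n * expi n x)
  simp only [trigPoly_apply]
  have h3 : ∀ x : ℝ≥0∞, x ^ (((2 : NNReal) : ℝ)) = x ^ 2 := fun x => by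
    rw [← ENNReal.rpow_natCast]; norm_num
  simp only [h3] at h2
  rw [← h2]
  calc _ < (ε ^ (1 / 2 : ℝ)) ^ 2 := by
        exact ENNReal.pow_lt_pow_left (by norm_num) h
    _ = ε := by
        rw [← ENNReal.rpow_natCast, ← ENNReal.rpow_mul]; norm_num

/-! ### Density of trigonometric polynomials -/

/-- If `0 ≤ q = Re k`, the multiplier `t / (t + k)` is at most `min 1 (t / q)`. -/
lemma norm_mul_inv_le {t q : ℝ} (ht : 0 < t) (hq : 0 ≤ q) {k : ℂ} (hk : k.re = q) :
    ‖(t : ℂ) * (t + k)⁻¹‖ ≤ 1 ∧ ‖(t : ℂ) * (t + k)⁻¹‖ * q ≤ t := by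
  have h1 : t + q ≤ ‖(t : ℂ) + k‖ := by
    have := Complex.re_le_norm ((t : ℂ) + k)
    simpa [hk] using this
  have h2 : 0 < ‖(t : ℂ) + k‖ := by linarith
  rw [norm_mul, norm_inv, Complex.norm_real, Real.norm_eq_abs, abs_of_pos ht, ← div_eq_mul_inv]
  constructor
  · rw [div_le_one h2]; linarith
  · rw [div_mul_eq_mul_div, div_le_iff₀ h2]
    gcongr
    linarith

lemma tendsto_natCast_mul_inv_add (k : ℂ) :
    Tendsto (fun n : ℕ => (((n + 1 : ℕ) : ℝ) : ℂ) * ((((n + 1 : ℕ) : ℝ) : ℂ) + k)⁻¹) atTop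
      (𝓝 1) := by
  have h1 : Tendsto (fun n : ℕ => ((n : ℂ))⁻¹) atTop (𝓝 0) := tendsto_inv_atTop_nhds_zero_nat
  have h2 : Tendsto (fun n : ℕ => (1 + k * ((n : ℂ))⁻¹)⁻¹) atTop (𝓝 1) := by
    have := ((h1.const_mul k).const_add 1).inv₀ (by simp)
    simpa using this
  refine (h2.comp (tendsto_add_atTop_nat 1)).congr fun n => ?_
  have hn : ((n + 1 : ℕ) : ℂ) ≠ 0 := by exact_mod_cast Nat.succ_ne_zero n
  simp only [Function.comp_apply, Complex.ofReal_natCast]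
  set m : ℂ := ((n + 1 : ℕ) : ℂ)
  have : m + k = m * (1 + k * m⁻¹) := by field_simp
  rw [this, mul_inv, ← mul_assoc, mul_inv_cancel₀ hn, one_mul]

/-- A function in `L₁ ∩ L₂(f)` with negative spectrum lies in the closed span of the exponentials
with negative frequencies. The weight admits no further regularity, so `h` is first multiplied by
bounded antianalytic functions `g` which are small where `h` or `f` is large. -/
lemma mem_L2s_empty_of_hasNegativeSpectrum {f : ℝ → Matrix (Fin T) (Fin T) ℂ}
    (hf : IsSpectralDensity f) {h : ℝ → Fin T → ℂ} (hh : h ∈ L2 f)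
    (hneg : ∀ i, HasNegativeSpectrum fun x => h x i) : h ∈ L2s ∅ f := by
  set φ : ℝ → ℝ := fun x => ∑ i, ∑ j, ‖f x i j‖ with hφ
  have hφ0 : ∀ x, 0 ≤ φ x := fun x => by positivity
  have hφint : Integrable φ circleMeasure :=
    integrable_finsetSum _ fun i _ => integrable_finsetSum _ fun j _ => (hf.1 i j).norm
  have hhint : Integrable h circleMeasure := Integrable.of_eval fun i => (hneg i).1
  set q : ℝ → ℝ := fun x => √(‖h x‖ + φ x) with hq
  have hq0 : ∀ x, 0 ≤ q x := fun x => Real.sqrt_nonneg _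
  have hqsq : ∀ x, q x ^ 2 = ‖h x‖ + φ x := fun x =>
    Real.sq_sqrt (add_nonneg (norm_nonneg _) (hφ0 x))
  have hqm : MemLp q 2 circleMeasure := by
    rw [memLp_two_iff_integrable_sq]
    · simp only [hqsq]
      exact hhint.norm.add hφint
    · exact (hhint.1.norm.add hφint.1).aemeasurable.sqrt.aestronglyMeasurable
  obtain ⟨K, hK, hres⟩ := exists_resolvent_family hqm hq0
  set t : ℕ → ℝ := fun n => ((n + 1 : ℕ) : ℝ) with ht
  have htpos : ∀ n, 0 < t n := fun n => by simp only [ht]; positivity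
  set g : ℕ → ℝ → ℂ := fun n x => (t n : ℂ) * (t n + K x)⁻¹ with hg
  have hgBA : ∀ n, IsBoundedAntianalytic (g n) := fun n => (.mul (.const _) (hres _ (htpos n)))
  have hgb : ∀ n, ∀ᵐ x ∂circleMeasure, ‖g n x‖ ≤ 1 ∧ ‖g n x‖ * q x ≤ t n := fun n =>
    hK.mono fun x hx => norm_mul_inv_le (htpos n) (hq0 x) hx
  have hglim : ∀ x, Tendsto (fun n => g n x) atTop (𝓝 1) := fun x =>
    tendsto_natCast_mul_inv_add (K x)
  -- Each `g n ^ 2 • h` lies in the closed span.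
  have hmem : ∀ n, (fun x => g n x • g n x • h x) ∈ L2s ∅ f := by
    intro n
    have hgm := (hgBA n).aestronglyMeasurable
    have hb1 : ∀ᵐ x ∂circleMeasure, ‖g n x‖ ≤ 1 := (hgb n).mono fun x hx => hx.1
    have hgh : (fun x => g n x • h x) ∈ L2 f := L2_smul hf.isWeight hh hgm hb1
    refine L2s_of_forall_approx hf (L2_smul hf.isWeight hgh hgm hb1) fun ε hε => ?_
    have hu : ∀ i, HasNegativeSpectrum fun x => (g n x • h x) i := fun i =>
      (hgBA n).hasNegativeSpectrum_mul (hneg i)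
    have hu2 : ∀ i, MemLp (fun x => (g n x • h x) i) 2 circleMeasure := by
      intro i
      rw [memLp_two_iff_integrable_sq_norm (hu i).1.1]
      refine (hhint.norm.const_mul (t n ^ 2)).mono' ((hu i).1.1.norm.pow 2) ?_
      filter_upwards [hgb n] with x hx
      have h1 : ‖h x i‖ ≤ ‖h x‖ := norm_le_pi_norm _ i
      have h2 : ‖h x‖ ≤ q x ^ 2 := by rw [hqsq]; linarith [hφ0 x]
      rw [norm_pow, norm_norm, Pi.smul_apply, smul_eq_mul, norm_mul]
      calc (‖g n x‖ * ‖h x i‖) ^ 2 ≤ (‖g n x‖ * ‖h x‖) ^ 2 := by gcongr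
        _ = ‖g n x‖ ^ 2 * ‖h x‖ * ‖h x‖ := by ring
        _ ≤ ‖g n x‖ ^ 2 * q x ^ 2 * ‖h x‖ := by gcongr
        _ = (‖g n x‖ * q x) ^ 2 * ‖h x‖ := by ring
        _ ≤ t n ^ 2 * ‖h x‖ := by
          have := mul_nonneg (norm_nonneg (g n x)) (hq0 x)
          have := hx.2
          gcongr
    set A : ℝ≥0∞ := ENNReal.ofReal (1 / (2 * Real.pi)) * (ENNReal.ofReal (t n ^ 2) * T) with hA
    have hAtop : A ≠ ∞ := by simp [hA, ENNReal.mul_eq_top]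
    obtain ⟨η, hη, hηε⟩ := ENNReal.exists_nnreal_pos_mul_lt hAtop hε.ne'
    obtain ⟨F, v, hF, hFv⟩ := exists_trigPoly_lintegral_sq_lt hu hu2 (ENNReal.coe_pos.2 hη)
    refine ⟨_, (hgBA n).smul_mem_L2s hf (trigPoly_mem_L2s hf
      (fun m hm => mem_observed_empty.2 (hF m hm)) v), ?_⟩
    have hpt : ∀ᵐ x ∂circleMeasure, ENNReal.ofReal (quadForm (f x)
        (g n x • g n x • h x - g n x • trigPoly F v x))
        ≤ ENNReal.ofReal (t n ^ 2) * ∑ i, ‖(g n x • h x) i - trigPoly F v x i‖ₑ ^ 2 := by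
      filter_upwards [hgb n] with x hx
      rw [← smul_sub, quadForm_smul]
      set y := g n x • h x - trigPoly F v x with hy
      have h1 : ‖y‖ ^ 2 ≤ ∑ i, ‖y i‖ ^ 2 := by
        have h0 : ‖y‖ ≤ √(∑ i, ‖y i‖ ^ 2) := by
          refine (pi_norm_le_iff_of_nonneg (Real.sqrt_nonneg _)).2 fun i => ?_
          refine Real.le_sqrt_of_sq_le ?_
          exact Finset.single_le_sum (f := fun i => ‖y i‖ ^ 2) (fun j _ => by positivity)
            (Finset.mem_univ i)
        calc ‖y‖ ^ 2 ≤ (√(∑ i, ‖y i‖ ^ 2)) ^ 2 := by gcongr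
          _ = _ := Real.sq_sqrt (by positivity)
      have h2 : φ x ≤ q x ^ 2 := by rw [hqsq]; linarith [norm_nonneg (h x)]
      have h3 : ‖g n x‖ ^ 2 * quadForm (f x) y ≤ t n ^ 2 * ∑ i, ‖y i‖ ^ 2 := by
        calc ‖g n x‖ ^ 2 * quadForm (f x) y ≤ ‖g n x‖ ^ 2 * (φ x * ‖y‖ ^ 2) := by
              gcongr; exact quadForm_le _ _
          _ ≤ ‖g n x‖ ^ 2 * (q x ^ 2 * ∑ i, ‖y i‖ ^ 2) := by gcongr
          _ = (‖g n x‖ * q x) ^ 2 * ∑ i, ‖y i‖ ^ 2 := by ring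
          _ ≤ t n ^ 2 * ∑ i, ‖y i‖ ^ 2 := by
            have := mul_nonneg (norm_nonneg (g n x)) (hq0 x)
            have := hx.2
            gcongr
      refine (ENNReal.ofReal_le_ofReal h3).trans (le_of_eq ?_)
      rw [ENNReal.ofReal_mul (by positivity), ENNReal.ofReal_sum_of_nonneg
        (fun i _ => by positivity)]
      congr 1
      refine Finset.sum_congr rfl fun i _ => ?_
      rw [ENNReal.ofReal_pow (norm_nonneg _), ofReal_norm]
      rfl
    have hum : ∀ i, AEMeasurable (fun x => ‖(g n x • h x) i - trigPoly F v x i‖ₑ ^ 2)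
        circleMeasure := fun i =>
      ((hu i).1.1.sub ((continuous_apply i).comp
        (continuous_trigPoly F v)).aestronglyMeasurable).enorm.pow_const 2
    rw [weightedSq_eq]
    refine lt_of_le_of_lt ?_ hηε
    rw [hA, mul_left_comm]
    refine mul_le_mul_right ((lintegral_mono_ae hpt).trans ?_) _
    rw [lintegral_const_mul' _ _ ENNReal.ofReal_ne_top, mul_left_comm,
      lintegral_finsetSum' _ fun i _ => hum i]
    refine mul_le_mul_right ((Finset.sum_le_sum fun i _ => (hFv i).le).trans (le_of_eq ?_)) _
    simp [mul_comm]
  refine L2s_of_forall_approx hf hh fun ε hε => ?_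
  have hlim := tendsto_weightedSq_smul hf.isWeight (g := fun n x => 1 - g n x * g n x) (R := 2)
    (fun n => aestronglyMeasurable_const.sub
      ((hgBA n).aestronglyMeasurable.mul (hgBA n).aestronglyMeasurable))
    (fun n => by
      filter_upwards [hgb n] with x hx
      refine (norm_sub_le _ _).trans ?_
      rw [norm_one, norm_mul]
      have := mul_le_one₀ hx.1 (norm_nonneg _) hx.1
      linarith)
    (Eventually.of_forall fun x => by
      simpa using ((hglim x).mul (hglim x)).const_sub 1)
    hh
  obtain ⟨n, hn⟩ := (hlim.eventually_lt_const hε).exists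
  refine ⟨_, hmem n, ?_⟩
  simpa only [sub_smul, one_smul, mul_smul] using hn

/-! ### Integrals of trigonometric polynomials -/

/-- Cauchy–Schwarz for `∫ |u|` when `|u|² ≤ A B`. -/
lemma lintegral_enorm_le_of_sq_le {u : ℝ → ℂ} {A B : ℝ → ℝ} (hA : AEMeasurable A circleMeasure)
    (hB : AEMeasurable B circleMeasure)
    (h : ∀ᵐ x ∂circleMeasure, 0 ≤ A x ∧ 0 ≤ B x ∧ ‖u x‖ ^ 2 ≤ A x * B x) :
    ∫⁻ x, ‖u x‖ₑ ∂circleMeasure ≤ (∫⁻ x, ENNReal.ofReal (A x) ∂circleMeasure) ^ (1 / 2 : ℝ) *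
      (∫⁻ x, ENNReal.ofReal (B x) ∂circleMeasure) ^ (1 / 2 : ℝ) := by
  have hH := ENNReal.lintegral_mul_le_Lp_mul_Lq circleMeasure Real.HolderConjugate.two_two
    hA.sqrt.ennreal_ofReal hB.sqrt.ennreal_ofReal
  have hsq : ∀ y : ℝ, 0 ≤ y → ENNReal.ofReal √y ^ (2 : ℝ) = ENNReal.ofReal y := fun y hy => by
    rw [ENNReal.ofReal_rpow_of_nonneg (Real.sqrt_nonneg y) (by norm_num)]
    congr 1
    exact_mod_cast Real.sq_sqrt hy
  have e1 : ∫⁻ x, ENNReal.ofReal √(A x) ^ (2 : ℝ) ∂circleMeasure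
      = ∫⁻ x, ENNReal.ofReal (A x) ∂circleMeasure :=
    lintegral_congr_ae (h.mono fun x hx => hsq _ hx.1)
  have e2 : ∫⁻ x, ENNReal.ofReal √(B x) ^ (2 : ℝ) ∂circleMeasure
      = ∫⁻ x, ENNReal.ofReal (B x) ∂circleMeasure :=
    lintegral_congr_ae (h.mono fun x hx => hsq _ hx.2.1)
  rw [e1, e2] at hH
  refine le_trans (lintegral_mono_ae ?_) hH
  filter_upwards [h] with x hx
  rw [Pi.mul_apply, ← ENNReal.ofReal_mul (Real.sqrt_nonneg _), ← Real.sqrt_mul hx.1, ← ofReal_norm]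
  exact ENNReal.ofReal_le_ofReal (Real.le_sqrt_of_sq_le hx.2.2)

lemma integral_trigPoly_mul_expi (F : Finset ℤ) (v : ℤ → Fin T → ℂ) (i : Fin T) (k : ℤ) :
    ∫ x, trigPoly F v x i * expi (-k) x ∂circleMeasure
      = if k ∈ F then 2 * (Real.pi : ℂ) * v k i else 0 := by
  simp only [trigPoly_apply, Finset.sum_mul, mul_assoc, ← expi_add]
  rw [integral_finsetSum]
  · simp only [integral_const_mul, integral_expi]
    have : ∀ n : ℤ, n + -k = 0 ↔ n = k := fun n => by omega
    simp only [this, mul_ite, mul_zero, Finset.sum_ite_eq']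
    congr 1
    ring
  · intro n _
    exact (integrable_of_continuous_of_bound (continuous_expi _)
      (fun x => (norm_expi _ x).le)).const_mul _

lemma integrable_trigPoly (F : Finset ℤ) (v : ℤ → Fin T → ℂ) (i : Fin T) :
    Integrable (fun x => trigPoly F v x i) circleMeasure :=
  integrable_of_continuous_of_bound ((continuous_apply i).comp (continuous_trigPoly F v))
    fun x => (norm_le_pi_norm _ i).trans (norm_trigPoly_le F v x)

/-! ### Reinforcing a weight -/

lemma quadForm_add_smul_one (M : Matrix (Fin T) (Fin T) ℂ) (r : ℝ) (b : Fin T → ℂ) :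
    quadForm (M + (r : ℂ) • (1 : Matrix (Fin T) (Fin T) ℂ)) b
      = quadForm M b + r * ∑ i, ‖b i‖ ^ 2 := by
  unfold quadForm
  rw [Matrix.add_mulVec, dotProduct_add, Complex.add_re, Matrix.smul_mulVec, Matrix.one_mulVec,
    dotProduct_smul, smul_eq_mul, Complex.re_ofReal_mul]
  congr 2
  simp only [dotProduct, Pi.star_apply, Complex.star_def, Complex.mul_conj, Complex.re_sum,
    Complex.ofReal_re, Complex.normSq_eq_norm_sq]

lemma isSpectralDensity_add_smul_one {f : ℝ → Matrix (Fin T) (Fin T) ℂ} (hf : IsSpectralDensity f)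
    {ρ : ℝ → ℝ} (hρ : Integrable ρ circleMeasure) (hρ0 : ∀ x, 0 ≤ ρ x) :
    IsSpectralDensity fun x => f x + (ρ x : ℂ) • (1 : Matrix (Fin T) (Fin T) ℂ) := by
  refine ⟨fun i j => ?_, ?_⟩
  · simp only [Matrix.add_apply, Matrix.smul_apply, smul_eq_mul]
    exact (hf.1 i j).add (hρ.ofReal.mul_const _)
  · filter_upwards [hf.2] with x hx
    refine hx.add (Matrix.PosSemidef.one.smul ?_)
    exact_mod_cast hρ0 x

/-- Membership of `h` in the closed span of the observed exponentials is detected by its Fourier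
coefficients. The weight is reinforced by `1 / (1 + ‖h‖)`, which leaves `h` in the space and makes
convergence in the mean square imply convergence of Fourier coefficients; hence the terms of the
approximants at the finitely many missing frequencies are negligible and may be dropped. -/
lemma mem_L2s_of_fourier_eq_zero {S : Finset ℤ} {f : ℝ → Matrix (Fin T) (Fin T) ℂ}
    (hf : IsSpectralDensity f) {h : ℝ → Fin T → ℂ} (hh : h ∈ L2 f)
    (hint : ∀ i, Integrable (fun x => h x i) circleMeasure)
    (hcoef : ∀ k ∈ unobserved S, ∀ i, ∫ x, h x i * expi (-k) x ∂circleMeasure = 0) :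
    h ∈ L2s S f := by
  have hhint : Integrable h circleMeasure := Integrable.of_eval hint
  set ρ : ℝ → ℝ := fun x => (1 + ‖h x‖)⁻¹ with hρ
  have hρ0 : ∀ x, 0 ≤ ρ x := fun x => by positivity
  have hρint : Integrable ρ circleMeasure := by
    refine Integrable.of_bound ((aemeasurable_const.add hhint.1.norm.aemeasurable).inv
      |>.aestronglyMeasurable) 1 (Eventually.of_forall fun x => ?_)
    rw [Real.norm_eq_abs, abs_of_nonneg (hρ0 x)]
    exact inv_le_one_of_one_le₀ (by linarith [norm_nonneg (h x)])
  set f' : ℝ → Matrix (Fin T) (Fin T) ℂ :=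
    fun x => f x + (ρ x : ℂ) • (1 : Matrix (Fin T) (Fin T) ℂ) with hf'def
  have hf' : IsSpectralDensity f' := isSpectralDensity_add_smul_one hf hρint hρ0
  have hquad : ∀ x b, quadForm (f' x) b = quadForm (f x) b + ρ x * ∑ i, ‖b i‖ ^ 2 := fun x b =>
    quadForm_add_smul_one _ _ _
  have hh' : h ∈ L2 f' := by
    refine ⟨hh.1, ?_⟩
    rw [weightedSq_eq]
    refine ENNReal.mul_lt_top ENNReal.ofReal_lt_top ?_
    have hb : ∀ x, quadForm (f' x) (h x) ≤ quadForm (f x) (h x) + T * ‖h x‖ := by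
      intro x
      rw [hquad]
      refine add_le_add le_rfl ?_
      have h1 : ∑ i, ‖h x i‖ ^ 2 ≤ T * ‖h x‖ ^ 2 := by
        calc ∑ i, ‖h x i‖ ^ 2 ≤ ∑ _i : Fin T, ‖h x‖ ^ 2 := by
              gcongr with i _; exact norm_le_pi_norm _ i
          _ = T * ‖h x‖ ^ 2 := by simp
      have h2 : ρ x * ‖h x‖ ≤ 1 := by
        rw [hρ, inv_mul_le_one₀ (by positivity)]; linarith
      calc ρ x * ∑ i, ‖h x i‖ ^ 2 ≤ ρ x * (T * ‖h x‖ ^ 2) := by gcongr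
        _ = T * ‖h x‖ * (ρ x * ‖h x‖) := by ring
        _ ≤ T * ‖h x‖ * 1 := by gcongr
        _ = _ := mul_one _
    refine lt_of_le_of_lt (lintegral_mono fun x =>
      (ENNReal.ofReal_le_ofReal (hb x)).trans ENNReal.ofReal_add_le) ?_
    rw [lintegral_add_left' (aemeasurable_quadForm hf.isWeight.meas hh.1).ennreal_ofReal,
      lintegral_quadForm_eq]
    exact ENNReal.add_lt_top.2 ⟨ENNReal.mul_lt_top ENNReal.ofReal_lt_top hh.2,
      (hhint.norm.const_mul (T : ℝ)).lintegral_lt_top⟩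
  have hneg : ∀ i, HasNegativeSpectrum fun x => h x i := fun i =>
    ⟨hint i, fun k => hcoef k (Or.inr (Int.natCast_nonneg k)) i⟩
  have hmem := mem_L2s_empty_of_hasNegativeSpectrum hf' hh' hneg
  have hpos : ∀ n : ℕ, (0 : ℝ≥0∞) < ((n : ℝ≥0∞) + 1)⁻¹ := fun n => by simp
  choose F v hF hv using fun n : ℕ => hmem.2 _ (hpos n)
  set Q : ℕ → ℝ≥0∞ := fun n => weightedSq f' (fun x => h x - trigPoly (F n) (v n) x) with hQ
  have hQlim : Tendsto Q atTop (𝓝 0) := by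
    refine tendsto_of_tendsto_of_tendsto_of_le_of_le tendsto_const_nhds ?_ (fun _ => zero_le)
      (fun n => (hv n).le)
    have h1 := ENNReal.tendsto_inv_nat_nhds_zero.comp (tendsto_add_atTop_nat 1)
    refine h1.congr fun n => ?_
    simp
  set I : ℝ≥0∞ := ∫⁻ x, ENNReal.ofReal (1 + ‖h x‖) ∂circleMeasure with hI
  have hItop : I ≠ ∞ := ((integrable_const 1).add hhint.norm).lintegral_lt_top.ne
  set J : ℕ → ℝ≥0∞ := fun n =>
    I ^ (1 / 2 : ℝ) * (ENNReal.ofReal (2 * Real.pi) * Q n) ^ (1 / 2 : ℝ) with hJ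
  have hdm : ∀ n, AEStronglyMeasurable (fun x => h x - trigPoly (F n) (v n) x) circleMeasure :=
    fun n => hh.1.sub (continuous_trigPoly _ _).aestronglyMeasurable
  have hL1 : ∀ n i, ∫⁻ x, ‖h x i - trigPoly (F n) (v n) x i‖ₑ ∂circleMeasure ≤ J n := by
    intro n i
    rw [hJ, hI, hQ]
    simp only
    rw [← lintegral_quadForm_eq]
    refine lintegral_enorm_le_of_sq_le (aemeasurable_const.add hhint.1.norm.aemeasurable)
      (aemeasurable_quadForm hf'.isWeight.meas (hdm n)) ?_
    filter_upwards [hf.2, hf'.2] with x hx hx'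
    refine ⟨by positivity, quadForm_nonneg hx' _, ?_⟩
    rw [hquad]
    set y := h x - trigPoly (F n) (v n) x
    have h1 : ‖y i‖ ^ 2 ≤ ∑ i, ‖y i‖ ^ 2 :=
      Finset.single_le_sum (f := fun i => ‖y i‖ ^ 2) (fun j _ => by positivity) (Finset.mem_univ i)
    have h2 := quadForm_nonneg hx y
    have h3 : (1 + ‖h x‖) * ρ x = 1 := mul_inv_cancel₀ (by positivity)
    calc ‖y i‖ ^ 2 ≤ ∑ i, ‖y i‖ ^ 2 := h1
      _ = ((1 + ‖h x‖) * ρ x) * ∑ i, ‖y i‖ ^ 2 := by rw [h3, one_mul]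
      _ ≤ (1 + ‖h x‖) * quadForm (f x) y + ((1 + ‖h x‖) * ρ x) * ∑ i, ‖y i‖ ^ 2 := by
        have : 0 ≤ (1 + ‖h x‖) * quadForm (f x) y := by positivity
        linarith
      _ = _ := by ring
  have hJlim : Tendsto J atTop (𝓝 0) := by
    have h1 : Tendsto (fun n => ENNReal.ofReal (2 * Real.pi) * Q n) atTop (𝓝 0) := by
      have h0 := ENNReal.Tendsto.const_mul (a := ENNReal.ofReal (2 * Real.pi)) hQlim
        (Or.inr ENNReal.ofReal_ne_top)
      rwa [mul_zero] at h0
    have h2 := (ENNReal.continuous_rpow_const (y := (1 / 2 : ℝ))).tendsto 0 |>.comp h1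
    rw [ENNReal.zero_rpow_of_pos (by norm_num)] at h2
    have hne : I ^ (1 / 2 : ℝ) ≠ ∞ := ENNReal.rpow_ne_top_of_nonneg (by norm_num) hItop
    have h3 := ENNReal.Tendsto.const_mul h2 (Or.inr hne)
    rwa [mul_zero] at h3
  have hJtop : ∀ n, J n ≠ ∞ := fun n =>
    ENNReal.mul_ne_top (ENNReal.rpow_ne_top_of_nonneg (by norm_num) hItop)
      (ENNReal.rpow_ne_top_of_nonneg (by norm_num)
        (ENNReal.mul_ne_top ENNReal.ofReal_ne_top ((hv n).trans_le le_top).ne))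
  -- The coefficients of the approximants at the missing frequencies tend to zero.
  have hcoefn : ∀ n, ∀ s ∈ F n ∩ S, ‖v n s‖ ≤ (J n).toReal := by
    intro n s hs
    obtain ⟨hsF, hsS⟩ := Finset.mem_inter.1 hs
    refine (pi_norm_le_iff_of_nonneg ENNReal.toReal_nonneg).2 fun i => ?_
    have h1 := integral_trigPoly_mul_expi (F n) (v n) i s
    rw [if_pos hsF] at h1
    have h2 : ∫ x, (h x i - trigPoly (F n) (v n) x i) * expi (-s) x ∂circleMeasure
        = -(2 * (Real.pi : ℂ) * v n s i) := by
      simp only [sub_mul]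
      rw [integral_sub (integrable_mul_expi (hint i) _)
        (integrable_mul_expi (integrable_trigPoly _ _ _) _), hcoef s (Or.inl hsS) i, h1, zero_sub]
    have h3 : ‖2 * (Real.pi : ℂ) * v n s i‖ ≤ (J n).toReal := by
      rw [← norm_neg, ← h2]
      refine (norm_integral_le_lintegral_norm _).trans (ENNReal.toReal_mono (hJtop n) ?_)
      refine le_trans (le_of_eq (lintegral_congr fun x => ?_)) (hL1 n i)
      rw [norm_mul, norm_expi, mul_one, ofReal_norm]
    rw [norm_mul, norm_mul] at h3
    have h4 : (1 : ℝ) ≤ ‖(2 : ℂ)‖ * ‖(Real.pi : ℂ)‖ := by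
      rw [Complex.norm_real, Real.norm_eq_abs, abs_of_pos Real.pi_pos]
      norm_num
      linarith [Real.pi_gt_three]
    nlinarith [norm_nonneg (v n s i)]
  have hrbound : ∀ n x, ‖trigPoly (F n ∩ S) (v n) x‖ ≤ S.card * (J n).toReal := by
    intro n x
    refine (norm_trigPoly_le _ _ _).trans ((Finset.sum_le_sum (hcoefn n)).trans ?_)
    rw [Finset.sum_const, nsmul_eq_mul]
    gcongr
    exact Finset.inter_subset_right
  have hrlim : Tendsto (fun n => weightedSq f (trigPoly (F n ∩ S) (v n))) atTop (𝓝 0) := by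
    refine tendsto_of_tendsto_of_tendsto_of_le_of_le tendsto_const_nhds ?_ (fun _ => zero_le)
      (fun n => weightedSq_le_of_bound hf (Eventually.of_forall (hrbound n)))
    have h1 : Tendsto (fun n => (J n).toReal) atTop (𝓝 0) := by
      exact (ENNReal.tendsto_toReal ENNReal.zero_ne_top).comp hJlim
    have h2 := ((h1.const_mul (S.card : ℝ)).pow 2).const_mul
      (∫ x, ∑ i, ∑ j, ‖f x i j‖ ∂circleMeasure)
    have h3 := ENNReal.Tendsto.const_mul (a := ENNReal.ofReal (1 / (2 * Real.pi)))
      (ENNReal.tendsto_ofReal h2) (Or.inr ENNReal.ofReal_ne_top)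
    simpa using h3
  refine ⟨hh, fun ε hε => ?_⟩
  have hε' : 0 < ε / 4 := ENNReal.div_pos hε.ne' (by simp)
  obtain ⟨n, hn1, hn2⟩ := ((hQlim.eventually_lt_const hε').and
    (hrlim.eventually_lt_const hε')).exists
  refine ⟨F n \ S, v n, fun m hm => ?_, ?_⟩
  · obtain ⟨h1, h2⟩ := Finset.mem_sdiff.1 hm
    exact ⟨mem_observed_empty.1 (hF n m h1), h2⟩
  · have e : (fun x => h x - trigPoly (F n \ S) (v n) x)
        = fun x => (h x - trigPoly (F n) (v n) x) + trigPoly (F n ∩ S) (v n) x := by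
      funext x
      have : trigPoly (F n) (v n) x
          = trigPoly (F n ∩ S) (v n) x + trigPoly (F n \ S) (v n) x := by
        have h1 := Finset.sum_sdiff (f := fun m => expi m x • v n m)
          (Finset.inter_subset_left : F n ∩ S ⊆ F n)
        rw [Finset.sdiff_inter_self_left, add_comm] at h1
        exact h1.symm
      rw [this]; abel
    rw [e]
    refine (weightedSq_add_le hf.isWeight (hdm n)).trans_lt (two_mul_add_two_mul_lt ?_ hn2)
    refine (weightedSq_mono (Eventually.of_forall fun x => ?_)).trans_lt hn1
    rw [hquad]
    have : 0 ≤ ρ x * ∑ i, ‖(h x - trigPoly (F n) (v n) x) i‖ ^ 2 :=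
      mul_nonneg (hρ0 x) (by positivity)
    linarith

/-! ### Fourier coefficients of `A` -/

lemma summable_blockCoeff (hT : 0 < T) {a : ℕ → ℂ} (ha : Summable fun j => ‖a j‖) (i : Fin T) :
    Summable fun j => ‖(blockCoeff a j : Fin T → ℂ) i‖ := by
  have hinj : Function.Injective fun j : ℕ => j * T + (i : ℕ) + 1 := by
    intro j k h
    have : j * T = k * T := by simpa using h
    exact Nat.eq_of_mul_eq_mul_right hT this
  exact ha.comp_injective hinj

lemma continuous_symbolA (hT : 0 < T) {a : ℕ → ℂ} (ha : Summable fun j => ‖a j‖) :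
    Continuous (symbolA a : ℝ → Fin T → ℂ) := by
  refine continuous_pi fun i => ?_
  refine continuous_tsum (fun j => continuous_const.mul (continuous_expi _))
    (summable_blockCoeff hT ha i) fun j x => ?_
  rw [norm_mul, norm_expi, mul_one]

lemma exists_norm_symbolA_le (hT : 0 < T) {a : ℕ → ℂ} (ha : Summable fun j => ‖a j‖) :
    ∃ R : ℝ, ∀ x, ‖(symbolA a x : Fin T → ℂ)‖ ≤ R := by
  refine ⟨∑ i : Fin T, ∑' j, ‖(blockCoeff a j : Fin T → ℂ) i‖, fun x => ?_⟩
  refine (pi_norm_le_iff_of_nonneg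
    (Finset.sum_nonneg fun i _ => tsum_nonneg fun j => norm_nonneg _)).2 fun i => ?_
  have h1 : ‖(symbolA a x : Fin T → ℂ) i‖ ≤ ∑' j, ‖(blockCoeff a j : Fin T → ℂ) i‖ :=
    tsum_of_norm_bounded (summable_blockCoeff hT ha i).hasSum fun j => by
      rw [norm_mul, norm_expi, mul_one]
  exact h1.trans (Finset.single_le_sum
    (f := fun i : Fin T => ∑' j, ‖(blockCoeff a j : Fin T → ℂ) i‖)
    (fun i _ => tsum_nonneg fun j => norm_nonneg _) (Finset.mem_univ i))

lemma integral_symbolA_mul_expi (hT : 0 < T) {a : ℕ → ℂ} (ha : Summable fun j => ‖a j‖)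
    (i : Fin T) (k : ℤ) :
    ∫ x, (symbolA a x : Fin T → ℂ) i * expi (-k) x ∂circleMeasure
      = 2 * (Real.pi : ℂ) * (rhs a k : Fin T → ℂ) i := by
  have hterm : ∀ (j : ℕ) (x : ℝ), (blockCoeff a j : Fin T → ℂ) i * expi j x * expi (-k) x
      = (blockCoeff a j : Fin T → ℂ) i * expi (j + -k) x := fun j x => by
    rw [mul_assoc, ← expi_add]
  have h1 : ∀ j : ℕ, Integrable (fun x => (blockCoeff a j : Fin T → ℂ) i * expi (j + -k) x)
      circleMeasure := fun j =>
    (integrable_of_continuous_of_bound (continuous_expi _)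
      (fun x => (norm_expi _ x).le)).const_mul _
  have h2 : Summable fun j : ℕ =>
      ∫ x, ‖(blockCoeff a j : Fin T → ℂ) i * expi (j + -k) x‖ ∂circleMeasure := by
    simp only [norm_mul, norm_expi, mul_one, integral_const, smul_eq_mul]
    exact (summable_blockCoeff hT ha i).mul_left _
  have h3 := integral_tsum_of_summable_integral_norm h1 h2
  simp only [symbolA, ← tsum_mul_right, hterm]
  rw [← h3]
  simp only [integral_const_mul, integral_expi]
  by_cases hk : 0 ≤ k
  · rw [tsum_eq_single k.toNat]
    · have : (k.toNat : ℤ) + -k = 0 := by omega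
      rw [if_pos this, rhs, if_pos hk, mul_comm]
    · intro j hj
      have : (j : ℤ) + -k ≠ 0 := by omega
      rw [if_neg this, mul_zero]
  · have : ∀ j : ℕ, (j : ℤ) + -k ≠ 0 := fun j => by omega
    simp [this, rhs, hk]

/-! ### Convergence of Fourier coefficients in weighted spaces -/

/-- Cauchy–Schwarz: `∫ |(bᵀ w)_i| ≤ (∫ w_ii)^{1/2} (∫ bᵀ w conj(b))^{1/2}`. -/
lemma lintegral_vecMul_le {w : ℝ → Matrix (Fin T) (Fin T) ℂ} (hw : IsWeight w)
    {b : ℝ → Fin T → ℂ} (hb : AEStronglyMeasurable b circleMeasure) (i : Fin T) :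
    ∫⁻ x, ‖Matrix.vecMul (b x) (w x) i‖ₑ ∂circleMeasure
      ≤ (∫⁻ x, ENNReal.ofReal (w x i i).re ∂circleMeasure) ^ (1 / 2 : ℝ) *
        (ENNReal.ofReal (2 * Real.pi) * weightedSq w b) ^ (1 / 2 : ℝ) := by
  rw [← lintegral_quadForm_eq]
  refine lintegral_enorm_le_of_sq_le (Complex.measurable_re.comp_aemeasurable (hw.meas i i))
    (aemeasurable_quadForm hw.meas hb) ?_
  filter_upwards [hw.psd] with x hx
  exact ⟨(Complex.le_def.mp (hx.diag_nonneg (i := i))).1, quadForm_nonneg hx _,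
    norm_vecMul_sq_le hx _ i⟩

lemma integrable_vecMul {w : ℝ → Matrix (Fin T) (Fin T) ℂ} (hw : IsWeight w)
    {i : Fin T} (hi : ∫⁻ x, ENNReal.ofReal (w x i i).re ∂circleMeasure ≠ ∞)
    {b : ℝ → Fin T → ℂ} (hb : b ∈ L2 w) :
    Integrable (fun x => Matrix.vecMul (b x) (w x) i) circleMeasure := by
  refine ⟨(continuous_apply i).comp_aestronglyMeasurable
    (aestronglyMeasurable_vecMul hw.meas hb.1), ?_⟩
  refine (lintegral_vecMul_le hw hb.1 i).trans_lt (ENNReal.mul_lt_top ?_ ?_)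
  · exact (ENNReal.rpow_ne_top_of_nonneg (by norm_num) hi).lt_top
  · exact (ENNReal.rpow_ne_top_of_nonneg (by norm_num)
      (ENNReal.mul_ne_top ENNReal.ofReal_ne_top hb.2.ne)).lt_top

lemma tendsto_integral_vecMul_mul_expi {w : ℝ → Matrix (Fin T) (Fin T) ℂ} (hw : IsWeight w)
    {i : Fin T} (hi : ∫⁻ x, ENNReal.ofReal (w x i i).re ∂circleMeasure ≠ ∞)
    {b : ℝ → Fin T → ℂ} (hb : b ∈ L2 w) {b' : ℕ → ℝ → Fin T → ℂ} (hb' : ∀ L, b' L ∈ L2 w)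
    (hlim : Tendsto (fun L => weightedSq w (fun x => b x - b' L x)) atTop (𝓝 0)) (k : ℤ) :
    Tendsto (fun L => ∫ x, Matrix.vecMul (b' L x) (w x) i * expi k x ∂circleMeasure) atTop
      (𝓝 (∫ x, Matrix.vecMul (b x) (w x) i * expi k x ∂circleMeasure)) := by
  refine tendsto_integral_of_L1 _ (integrable_mul_expi (integrable_vecMul hw hi hb) k).1
    (Eventually.of_forall fun L => integrable_mul_expi (integrable_vecMul hw hi (hb' L)) k) ?_
  have hle : ∀ L, ∫⁻ x, ‖Matrix.vecMul (b' L x) (w x) i * expi k x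
      - Matrix.vecMul (b x) (w x) i * expi k x‖ₑ ∂circleMeasure
      ≤ (∫⁻ x, ENNReal.ofReal (w x i i).re ∂circleMeasure) ^ (1 / 2 : ℝ) *
        (ENNReal.ofReal (2 * Real.pi) * weightedSq w (fun x => b x - b' L x)) ^ (1 / 2 : ℝ) := by
    intro L
    refine le_trans (le_of_eq (lintegral_congr fun x => ?_))
      (lintegral_vecMul_le hw (hb.1.sub (hb' L).1) i)
    rw [← sub_mul, enorm_mul, Pi.sub_apply, Matrix.sub_vecMul, Pi.sub_apply, ← enorm_neg, neg_sub]
    have : ‖expi k x‖ₑ = 1 := by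
      rw [← ofReal_norm, norm_expi, ENNReal.ofReal_one]
    rw [this, mul_one]
  refine tendsto_of_tendsto_of_tendsto_of_le_of_le tendsto_const_nhds ?_ (fun _ => zero_le) hle
  have h1 := ENNReal.Tendsto.const_mul (a := ENNReal.ofReal (2 * Real.pi)) hlim
    (Or.inr ENNReal.ofReal_ne_top)
  rw [mul_zero] at h1
  have h2 := (ENNReal.continuous_rpow_const (y := (1 / 2 : ℝ))).tendsto 0 |>.comp h1
  rw [ENNReal.zero_rpow_of_pos (by norm_num)] at h2
  have hne := ENNReal.rpow_ne_top_of_nonneg (x := ∫⁻ x, ENNReal.ofReal (w x i i).re ∂circleMeasure)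
    (y := 1 / 2) (by norm_num) hi
  have h3 := ENNReal.Tendsto.const_mul h2 (Or.inr hne)
  rwa [mul_zero] at h3

/-! ### The inverse density as a weight -/

lemma isWeight_inv {f : ℝ → Matrix (Fin T) (Fin T) ℂ} (hf : IsWeight f) :
    IsWeight fun x => (f x)⁻¹ := by
  have hfm : AEMeasurable (fun x i j => f x i j) circleMeasure :=
    aemeasurable_pi_iff.2 fun i => aemeasurable_pi_iff.2 fun j => hf.meas i j
  refine ⟨fun i j => ?_, hf.psd.mono fun x hx => hx.inv⟩
  have hdet : Continuous fun M : Fin T → Fin T → ℂ => (Matrix.of M).det :=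
    Continuous.matrix_det continuous_id
  have hadj : Continuous fun M : Fin T → Fin T → ℂ => (Matrix.of M).adjugate i j :=
    (Continuous.matrix_adjugate continuous_id).matrix_elem i j
  have e : (fun x => (f x)⁻¹ i j) = fun x => ((f x).det)⁻¹ * (f x).adjugate i j := by
    funext x
    rw [Matrix.inv_def, Matrix.smul_apply, Ring.inverse_eq_inv', smul_eq_mul]
  rw [e]
  exact (hdet.measurable.comp_aemeasurable hfm).inv.mul (hadj.measurable.comp_aemeasurable hfm)

lemma re_diag_le_re_trace {M : Matrix (Fin T) (Fin T) ℂ} (hM : M.PosSemidef) (i : Fin T) :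
    (M i i).re ≤ M.trace.re := by
  simp only [Matrix.trace, Matrix.diag, Complex.re_sum]
  exact Finset.single_le_sum (f := fun i => (M i i).re)
    (fun j _ => (Complex.le_def.mp (hM.diag_nonneg (i := j))).1) (Finset.mem_univ i)

lemma norm_entry_le_re_trace {M : Matrix (Fin T) (Fin T) ℂ} (hM : M.PosSemidef) (m i : Fin T) :
    ‖M m i‖ ≤ M.trace.re := by
  have h := norm_vecMul_sq_le hM (Pi.single m 1) i
  have e1 : Matrix.vecMul (Pi.single m 1) M i = M m i := by simp
  have e2 : quadForm M (Pi.single m 1 : Fin T → ℂ) = (M m m).re := by simp [quadForm]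
  rw [e1, e2] at h
  have hi := re_diag_le_re_trace hM i
  have hm := re_diag_le_re_trace hM m
  have hi0 : 0 ≤ (M i i).re := (Complex.le_def.mp (hM.diag_nonneg (i := i))).1
  have hm0 : 0 ≤ (M m m).re := (Complex.le_def.mp (hM.diag_nonneg (i := m))).1
  refine le_of_sq_le_sq (h.trans ?_) (hi0.trans hi)
  rw [pow_two]
  exact mul_le_mul hi hm hm0 (hi0.trans hi)

lemma integrable_inv_entry {f : ℝ → Matrix (Fin T) (Fin T) ℂ} (hf : IsWeight f)
    (hmin : Minimality f) (m i : Fin T) :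
    Integrable (fun x => (f x)⁻¹ m i) circleMeasure := by
  have hw := isWeight_inv hf
  refine hmin.2.re.mono' (hw.meas m i).aestronglyMeasurable ?_
  filter_upwards [hw.psd] with x hx
  exact norm_entry_le_re_trace hx m i

lemma lintegral_re_ne_top {u : ℝ → ℂ} (hu : Integrable u circleMeasure) :
    ∫⁻ x, ENNReal.ofReal (u x).re ∂circleMeasure ≠ ∞ :=
  hu.re.lintegral_lt_top.ne

/-- The Fourier coefficients of `pᵀ f⁻¹`, for a trigonometric polynomial `p`, are given by the
blocks of the matrix `B`. -/
lemma integral_vecMul_inv_trigPoly {f : ℝ → Matrix (Fin T) (Fin T) ℂ} (hf : IsWeight f)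
    (hmin : Minimality f) (F : Finset ℤ) (c : ℤ → Fin T → ℂ) (k : ℤ) (i : Fin T) :
    ∫ x, Matrix.vecMul (trigPoly F c x) (f x)⁻¹ i * expi (-k) x ∂circleMeasure
      = 2 * (Real.pi : ℂ) * (∑ j ∈ F, Matrix.mulVec (blockB f k j) (c j)) i := by
  have hpi : (Real.pi : ℂ) ≠ 0 := by exact_mod_cast Real.pi_ne_zero
  have e : ∀ x, Matrix.vecMul (trigPoly F c x) (f x)⁻¹ i * expi (-k) x
      = ∑ j ∈ F, ∑ m, c j m * ((f x)⁻¹ m i * expi (j - k) x) := by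
    intro x
    simp only [Matrix.vecMul, dotProduct, trigPoly_apply, Finset.sum_mul]
    rw [Finset.sum_comm]
    refine Finset.sum_congr rfl fun j _ => Finset.sum_congr rfl fun m _ => ?_
    rw [sub_eq_add_neg, expi_add]; ring
  simp only [e]
  have hint : ∀ (j : ℤ) (m : Fin T),
      Integrable (fun x => c j m * ((f x)⁻¹ m i * expi (j - k) x)) circleMeasure := fun j m =>
    (integrable_mul_expi (integrable_inv_entry hf hmin m i) _).const_mul _
  rw [integral_finsetSum _ fun j _ => integrable_finsetSum _ fun m _ => hint j m,
    Finset.sum_apply, Finset.mul_sum]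
  refine Finset.sum_congr rfl fun j _ => ?_
  rw [integral_finsetSum _ fun m _ => hint j m]
  simp only [Matrix.mulVec, dotProduct, blockB, Matrix.of_apply, Matrix.transpose_apply,
    Finset.mul_sum, integral_const_mul]
  refine Finset.sum_congr rfl fun m _ => ?_
  field_simp

/-! ### The estimation error of the spectral characteristic -/

/-- The row `Cᵀ f⁻¹`, the difference of `A` and the spectral characteristic. -/
noncomputable def residual (f : ℝ → Matrix (Fin T) (Fin T) ℂ) (C : ℝ → Fin T → ℂ) (x : ℝ) :
    Fin T → ℂ := Matrix.vecMul (C x) (f x)⁻¹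

lemma weightedSq_residual {f₀ : ℝ → Matrix (Fin T) (Fin T) ℂ} (hf₀ : IsWeight f₀)
    (f : ℝ → Matrix (Fin T) (Fin T) ℂ) (C : ℝ → Fin T → ℂ) :
    weightedSq f (residual f₀ C) = linFunctional f₀ C f :=
  weightedSq_congr (hf₀.psd.mono fun _ hx => quadForm_vecMul hx.inv.1 _ _)

lemma linFunctional_self {f₀ : ℝ → Matrix (Fin T) (Fin T) ℂ} (hmin : Minimality f₀)
    (C : ℝ → Fin T → ℂ) : linFunctional f₀ C f₀ = weightedSq (fun x => (f₀ x)⁻¹) C :=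
  weightedSq_congr (hmin.1.mono fun x hx => by
    simp only [Matrix.nonsing_inv_mul _ hx, one_mul])

lemma mse_specChar (a : ℕ → ℂ) {f₀ : ℝ → Matrix (Fin T) (Fin T) ℂ} (hf₀ : IsWeight f₀)
    (f : ℝ → Matrix (Fin T) (Fin T) ℂ) (C : ℝ → Fin T → ℂ) :
    mse a (specChar a f₀ C) f = linFunctional f₀ C f := by
  rw [← weightedSq_residual hf₀]
  simp only [mse, specChar, sub_sub_cancel]
  rfl

lemma vecMul_inv_vecMul {M : Matrix (Fin T) (Fin T) ℂ} (hM : IsUnit M.det) (b : Fin T → ℂ) :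
    Matrix.vecMul (Matrix.vecMul b M⁻¹) M = b := by
  rw [Matrix.vecMul_vecMul, Matrix.nonsing_inv_mul _ hM, Matrix.vecMul_one]

/-! ### Optimality and the minimax property -/

lemma isSpectralDensity_inv {f : ℝ → Matrix (Fin T) (Fin T) ℂ} (hf : IsWeight f)
    (hmin : Minimality f) : IsSpectralDensity fun x => (f x)⁻¹ :=
  ⟨integrable_inv_entry hf hmin, (isWeight_inv hf).psd⟩

lemma residual_mem_L2 {f₀ f : ℝ → Matrix (Fin T) (Fin T) ℂ} (hf₀ : IsWeight f₀)
    {C : ℝ → Fin T → ℂ} (hC : AEStronglyMeasurable C circleMeasure)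
    (hlt : linFunctional f₀ C f < ∞) : residual f₀ C ∈ L2 f :=
  ⟨aestronglyMeasurable_vecMul (isWeight_inv hf₀).meas hC, by rwa [weightedSq_residual hf₀]⟩

lemma residual_mem_L2_self {f₀ : ℝ → Matrix (Fin T) (Fin T) ℂ} (hf₀ : IsWeight f₀)
    (hmin : Minimality f₀) {C : ℝ → Fin T → ℂ} (hC : C ∈ L2 fun x => (f₀ x)⁻¹) :
    residual f₀ C ∈ L2 f₀ :=
  residual_mem_L2 hf₀ hC.1 (by rw [linFunctional_self hmin]; exact hC.2)

lemma integrable_residual {f₀ : ℝ → Matrix (Fin T) (Fin T) ℂ} (hf₀ : IsWeight f₀)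
    (hmin : Minimality f₀) {C : ℝ → Fin T → ℂ} (hC : C ∈ L2 fun x => (f₀ x)⁻¹) (i : Fin T) :
    Integrable (fun x => residual f₀ C x i) circleMeasure :=
  integrable_vecMul (isWeight_inv hf₀)
    (lintegral_re_ne_top (integrable_inv_entry hf₀ hmin i i)) hC

/-- The equations `B c = 𝐚` say that `Cᵀ f⁻¹` has the Fourier coefficients of `A` on `Γ`. -/
lemma integral_residual_mul_expi {S : Finset ℤ} {f₀ : ℝ → Matrix (Fin T) (Fin T) ℂ}
    (hf₀ : IsWeight f₀) (hmin : Minimality f₀) {c b : ℤ → Fin T → ℂ} {C : ℝ → Fin T → ℂ}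
    (hc : BSolves S f₀ c b) (hC : IsSeriesSum S f₀ c C) {k : ℤ} (hk : k ∈ unobserved S)
    (i : Fin T) :
    ∫ x, residual f₀ C x i * expi (-k) x ∂circleMeasure = 2 * (Real.pi : ℂ) * b k i := by
  have h1 := tendsto_integral_vecMul_mul_expi (isWeight_inv hf₀)
    (lintegral_re_ne_top (integrable_inv_entry hf₀ hmin i i)) hC.1
    (fun L => trigPoly_mem_L2 (isSpectralDensity_inv hf₀ hmin) (unobservedBelow S L) c) hC.2 (-k)
  simp only [integral_vecMul_inv_trigPoly hf₀ hmin] at h1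
  exact tendsto_nhds_unique h1 ((tendsto_pi_nhds.1 (hc k hk) i).const_mul _)

/-- The spectrum of `C` is contained in `Γ`. -/
lemma integral_seriesSum_mul_expi {S : Finset ℤ} {f₀ : ℝ → Matrix (Fin T) (Fin T) ℂ}
    (hf₀ : IsSpectralDensity f₀) (hmin : Minimality f₀) {c : ℤ → Fin T → ℂ} {C : ℝ → Fin T → ℂ}
    (hC : IsSeriesSum S f₀ c C) (i : Fin T) :
    Integrable (fun x => C x i) circleMeasure ∧
      ∀ n ∈ observed S, ∫ x, C x i * expi (-n) x ∂circleMeasure = 0 := by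
  have hw := hf₀.isWeight
  have hi := lintegral_re_ne_top (hf₀.1 i i)
  have hCL : ∀ L, trigPoly (unobservedBelow S L) c ∈ L2 fun x => (f₀ x)⁻¹ := fun L =>
    trigPoly_mem_L2 (isSpectralDensity_inv hw hmin) _ c
  have hback : ∀ b : ℝ → Fin T → ℂ,
      ∀ᵐ x ∂circleMeasure, Matrix.vecMul (residual f₀ b x) (f₀ x) i = b x i := fun b =>
    hmin.1.mono fun x hx => by rw [residual, vecMul_inv_vecMul hx]
  refine ⟨(integrable_vecMul hw hi (residual_mem_L2_self hw hmin hC.1)).congr (hback C),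
    fun n hn => ?_⟩
  have hlim : Tendsto (fun L => weightedSq f₀ (fun x => residual f₀ C x
      - residual f₀ (trigPoly (unobservedBelow S L) c) x)) atTop (𝓝 0) := by
    refine hC.2.congr fun L => ?_
    rw [← linFunctional_self hmin, ← weightedSq_residual hw]
    congr 1
    funext x
    simp only [residual, Matrix.sub_vecMul]
  have h1 := tendsto_integral_vecMul_mul_expi hw hi (residual_mem_L2_self hw hmin hC.1)
    (fun L => residual_mem_L2_self hw hmin (hCL L)) hlim (-n)
  have h2 : ∀ b : ℝ → Fin T → ℂ,
      ∫ x, Matrix.vecMul (residual f₀ b x) (f₀ x) i * expi (-n) x ∂circleMeasure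
        = ∫ x, b x i * expi (-n) x ∂circleMeasure := fun b =>
    integral_congr_ae ((hback b).mono fun x hx => by simp only [hx])
  simp only [h2] at h1
  refine tendsto_nhds_unique h1 (tendsto_const_nhds.congr fun L => ?_)
  rw [integral_trigPoly_mul_expi, if_neg]
  intro hmem
  rcases Finset.mem_union.1 hmem with h | h
  · exact hn.2 h
  · have := (Finset.mem_Ico.1 h).1
    have := hn.1
    omega

/-- The spectral characteristic belongs to `L₂ˢ(f)` for every density `f` at which the linear
functional is finite. -/
lemma specChar_mem_L2s (hT : 0 < T) {S : Finset ℤ} {a : ℕ → ℂ} (ha : Summable fun j => ‖a j‖)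
    {f₀ f : ℝ → Matrix (Fin T) (Fin T) ℂ} (hf₀ : IsWeight f₀) (hmin : Minimality f₀)
    {c : ℤ → Fin T → ℂ} {C : ℝ → Fin T → ℂ} (hc : BSolves S f₀ c (rhs a))
    (hC : IsSeriesSum S f₀ c C) (hf : IsSpectralDensity f) (hlt : linFunctional f₀ C f < ∞) :
    specChar a f₀ C ∈ L2s S f := by
  obtain ⟨R, hR⟩ := exists_norm_symbolA_le hT ha
  have hcont := continuous_symbolA hT ha
  have hA : (symbolA a : ℝ → Fin T → ℂ) ∈ L2 f :=
    ⟨hcont.aestronglyMeasurable, weightedSq_lt_top_of_bound hf (Eventually.of_forall hR)⟩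
  have hAint : ∀ i, Integrable (fun x => (symbolA a x : Fin T → ℂ) i) circleMeasure := fun i =>
    integrable_of_continuous_of_bound ((continuous_apply i).comp hcont)
      fun x => (norm_le_pi_norm _ i).trans (hR x)
  refine mem_L2s_of_fourier_eq_zero hf (L2_sub hf.isWeight hA (residual_mem_L2 hf₀ hC.1.1 hlt))
    (fun i => (hAint i).sub (integrable_residual hf₀ hmin hC.1 i)) fun k hk i => ?_
  have hsub : ∀ x, specChar a f₀ C x i = (symbolA a x : Fin T → ℂ) i - residual f₀ C x i :=
    fun _ => rfl
  simp only [hsub, sub_mul]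
  rw [integral_sub (integrable_mul_expi (hAint i) _)
    (integrable_mul_expi (integrable_residual hf₀ hmin hC.1 i) _),
    integral_symbolA_mul_expi hT ha, integral_residual_mul_expi hf₀ hmin hc hC hk, sub_self]

lemma integrable_quadForm {w : ℝ → Matrix (Fin T) (Fin T) ℂ} (hw : IsWeight w)
    {b : ℝ → Fin T → ℂ} (hb : b ∈ L2 w) :
    Integrable (fun x => quadForm (w x) (b x)) circleMeasure := by
  refine ⟨(aemeasurable_quadForm hw.meas hb.1).aestronglyMeasurable, ?_⟩
  rw [hasFiniteIntegral_iff_ofReal (hw.psd.mono fun x hx => quadForm_nonneg hx _),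
    lintegral_quadForm_eq]
  exact ENNReal.mul_lt_top ENNReal.ofReal_lt_top hb.2

lemma weightedSq_eq_ofReal_integral {w : ℝ → Matrix (Fin T) (Fin T) ℂ} (hw : IsWeight w)
    {b : ℝ → Fin T → ℂ} (hb : b ∈ L2 w) :
    weightedSq w b = ENNReal.ofReal (1 / (2 * Real.pi)) *
      ENNReal.ofReal (∫ x, quadForm (w x) (b x) ∂circleMeasure) := by
  rw [weightedSq_eq, ofReal_integral_eq_lintegral_ofReal (integrable_quadForm hw hb)
    (hw.psd.mono fun x hx => quadForm_nonneg hx _)]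

/-- The residual is orthogonal in `L₂(f₀)` to the observed exponentials, because its inner product
with `p` is `∫ Cᵀ conj(p)`. -/
lemma weightedSq_residual_le_add {S : Finset ℤ} {f₀ : ℝ → Matrix (Fin T) (Fin T) ℂ}
    (hf₀ : IsSpectralDensity f₀) (hmin : Minimality f₀) {c : ℤ → Fin T → ℂ} {C : ℝ → Fin T → ℂ}
    (hC : IsSeriesSum S f₀ c C) {F : Finset ℤ} (hF : ∀ n ∈ F, n ∈ observed S)
    (v : ℤ → Fin T → ℂ) :
    weightedSq f₀ (residual f₀ C)
      ≤ weightedSq f₀ (fun x => residual f₀ C x + trigPoly F v x) := by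
  have hw := hf₀.isWeight
  have hres := residual_mem_L2_self hw hmin hC.1
  have hsum := L2_add hw hres (trigPoly_mem_L2 hf₀ F v)
  have e : ∀ x, C x ⬝ᵥ star (trigPoly F v x)
      = ∑ i, ∑ n ∈ F, star (v n i) * (C x i * expi (-n) x) := by
    intro x
    simp only [dotProduct, Pi.star_apply, trigPoly_apply, star_sum, star_mul', star_expi,
      Finset.mul_sum]
    exact Finset.sum_congr rfl fun i _ => Finset.sum_congr rfl fun n _ => by ring
  have hCint := fun i => integral_seriesSum_mul_expi hf₀ hmin hC i
  have hint : ∀ (i : Fin T) (n : ℤ),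
      Integrable (fun x => star (v n i) * (C x i * expi (-n) x)) circleMeasure := fun i n =>
    (integrable_mul_expi (hCint i).1 _).const_mul _
  have hcross : Integrable (fun x => C x ⬝ᵥ star (trigPoly F v x)) circleMeasure := by
    simp only [e]
    exact integrable_finsetSum _ fun i _ => integrable_finsetSum _ fun n _ => hint i n
  have hcre : Integrable (fun x => (C x ⬝ᵥ star (trigPoly F v x)).re) circleMeasure := hcross.re
  have hzero : ∫ x, (C x ⬝ᵥ star (trigPoly F v x)).re ∂circleMeasure = 0 := by
    have h1 : ∫ x, C x ⬝ᵥ star (trigPoly F v x) ∂circleMeasure = 0 := by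
      simp only [e]
      rw [integral_finsetSum _ fun i _ => integrable_finsetSum _ fun n _ => hint i n]
      refine Finset.sum_eq_zero fun i _ => ?_
      rw [integral_finsetSum _ fun n _ => hint i n]
      refine Finset.sum_eq_zero fun n hn => ?_
      rw [integral_const_mul, (hCint i).2 n (hF n hn), mul_zero]
    have h2 := integral_re hcross
    rw [h1] at h2
    simpa using h2
  rw [weightedSq_eq_ofReal_integral hw hres, weightedSq_eq_ofReal_integral hw hsum]
  refine mul_le_mul_right (ENNReal.ofReal_le_ofReal ?_) _
  calc ∫ x, quadForm (f₀ x) (residual f₀ C x) ∂circleMeasure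
      = ∫ x, (quadForm (f₀ x) (residual f₀ C x)
          + 2 * (C x ⬝ᵥ star (trigPoly F v x)).re) ∂circleMeasure := by
        rw [integral_add (integrable_quadForm hw hres) (hcre.const_mul 2),
          integral_const_mul, hzero, mul_zero, add_zero]
    _ ≤ _ := by
        refine integral_mono_ae ((integrable_quadForm hw hres).add (hcre.const_mul 2))
          (integrable_quadForm hw hsum) ?_
        filter_upwards [hf₀.2, hmin.1] with x hx hdet
        have h1 := quadForm_nonneg hx (trigPoly F v x)
        rw [quadForm_add hx.1, Matrix.dotProduct_mulVec, residual, vecMul_inv_vecMul hdet]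
        linarith

lemma L2s_sub {S : Finset ℤ} {f : ℝ → Matrix (Fin T) (Fin T) ℂ}
    (hf : IsSpectralDensity f) {a b : ℝ → Fin T → ℂ} (ha : a ∈ L2s S f) (hb : b ∈ L2s S f) :
    (fun x => a x - b x) ∈ L2s S f := by
  have hneg : (fun x => (-1 : ℂ) • b x) ∈ L2s S f := by
    refine smul_mem_L2s_of_trigPoly hf aestronglyMeasurable_const (R := 1) (by simp)
      (fun F v hF => ?_) hb
    have e : (fun x => (-1 : ℂ) • trigPoly F v x) = trigPoly F fun n => -v n := by
      funext x
      simp [trigPoly]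
    rw [e]
    exact trigPoly_mem_L2s hf hF _
  simpa [sub_eq_add_neg] using L2s_add hf ha hneg

/-- A mean square which does not decrease when observed trigonometric polynomials are added to `e`
does not decrease when elements of their closed span are added. -/
lemma weightedSq_le_add_of_mem_L2s {S : Finset ℤ} {f : ℝ → Matrix (Fin T) (Fin T) ℂ}
    (hf : IsSpectralDensity f) {e d : ℝ → Fin T → ℂ} (he : e ∈ L2 f)
    (horth : ∀ (F : Finset ℤ) (v : ℤ → Fin T → ℂ), (∀ n ∈ F, n ∈ observed S) →
      weightedSq f e ≤ weightedSq f (fun x => e x + trigPoly F v x))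
    (hd : d ∈ L2s S f) : weightedSq f e ≤ weightedSq f (fun x => e x + d x) := by
  have hw := hf.isWeight
  have hed := L2_add hw he hd.1
  have hδ : ∀ δ : ℝ, 0 < δ →
      weightedSq f e ≤ ENNReal.ofReal (1 + δ) * weightedSq f (fun x => e x + d x) := by
    intro δ hδ
    refine ENNReal.le_of_forall_pos_le_add fun ε hε _ => ?_
    have hε' : 0 < (ε : ℝ≥0∞) / ENNReal.ofReal (1 + δ⁻¹) :=
      ENNReal.div_pos (ENNReal.coe_pos.2 hε).ne' ENNReal.ofReal_ne_top
    obtain ⟨F, v, hF, hlt⟩ := hd.2 _ hε'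
    rw [weightedSq_sub_comm] at hlt
    refine (horth F v hF).trans ?_
    have e1 : (fun x => e x + trigPoly F v x)
        = fun x => (e x + d x) + (trigPoly F v x - d x) := by
      funext x; abel
    rw [e1]
    refine (weightedSq_add_le_of_pos hw hed.1 hδ).trans (add_le_add le_rfl ?_)
    rw [mul_comm]
    exact (ENNReal.mul_lt_of_lt_div hlt).le
  have hlim : Tendsto (fun δ : ℝ => ENNReal.ofReal (1 + δ) * weightedSq f (fun x => e x + d x))
      (𝓝[>] 0) (𝓝 (weightedSq f (fun x => e x + d x))) := by
    have h1 : Tendsto (fun δ : ℝ => 1 + δ) (𝓝[>] 0) (𝓝 1) := by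
      have h := (continuous_const_add (1 : ℝ)).tendsto 0
      rw [add_zero] at h
      exact h.mono_left nhdsWithin_le_nhds
    have h2 := ENNReal.Tendsto.mul_const (ENNReal.tendsto_ofReal h1)
      (Or.inr hed.2.ne)
    simpa using h2
  exact ge_of_tendsto hlim (eventually_mem_nhdsWithin.mono hδ)

/-- The spectral characteristic minimizes the mean square error at its own density. -/
lemma isOptimal_specChar (hT : 0 < T) {S : Finset ℤ} {a : ℕ → ℂ} (ha : Summable fun j => ‖a j‖)
    {f₀ : ℝ → Matrix (Fin T) (Fin T) ℂ} (hf₀ : IsSpectralDensity f₀) (hmin : Minimality f₀)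
    {c : ℤ → Fin T → ℂ} {C : ℝ → Fin T → ℂ} (hc : BSolves S f₀ c (rhs a))
    (hC : IsSeriesSum S f₀ c C) : IsOptimal S a f₀ (specChar a f₀ C) := by
  have hw := hf₀.isWeight
  have hlt : linFunctional f₀ C f₀ < ∞ := by rw [linFunctional_self hmin]; exact hC.1.2
  have hmem := specChar_mem_L2s hT ha hw hmin hc hC hf₀ hlt
  refine ⟨hmem, le_antisymm (le_iInf₂ fun h hh => ?_) (iInf₂_le _ hmem)⟩
  rw [mse_specChar a hw, ← weightedSq_residual hw]
  refine (weightedSq_le_add_of_mem_L2s hf₀ (residual_mem_L2 hw hC.1.1 hlt)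
    (fun F v hF => weightedSq_residual_le_add hf₀ hmin hC hF v)
    (L2s_sub hf₀ hmem hh)).trans (le_of_eq ?_)
  unfold mse
  congr 1
  funext x
  simp only [specChar, residual]
  abel

/-- The least favorable density and the minimax characteristic, for an arbitrary finite set `S` of
missing times. -/
theorem isLeastFavorable_and_isMinimax (hT : 0 < T) {S : Finset ℤ} {a : ℕ → ℂ}
    (ha : Summable fun j => ‖a j‖) {D : Set (ℝ → Matrix (Fin T) (Fin T) ℂ)}
    (hD : ∀ f ∈ D, IsSpectralDensity f) {f₀ : ℝ → Matrix (Fin T) (Fin T) ℂ} (hf₀ : f₀ ∈ D)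
    (hmin : Minimality f₀) {c₀ : ℤ → Fin T → ℂ} {C₀ : ℝ → Fin T → ℂ}
    (hc₀ : BSolves S f₀ c₀ (rhs a)) (hC₀ : IsSeriesSum S f₀ c₀ C₀)
    (hmax : ∀ f ∈ D, linFunctional f₀ C₀ f ≤ linFunctional f₀ C₀ f₀) :
    IsLeastFavorable S a D f₀ ∧ IsOptimal S a f₀ (specChar a f₀ C₀) ∧
      (specChar a f₀ C₀ ∈ HD S D → IsMinimax S a D (specChar a f₀ C₀)) := by
  have hS₀ := hD f₀ hf₀
  have hw := hS₀.isWeight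
  have hopt := isOptimal_specChar hT ha hS₀ hmin hc₀ hC₀
  have hfin : linFunctional f₀ C₀ f₀ < ∞ := by
    rw [linFunctional_self hmin]; exact hC₀.1.2
  have hmse : ∀ f ∈ D, mse a (specChar a f₀ C₀) f ≤ mse a (specChar a f₀ C₀) f₀ := fun f hf => by
    rw [mse_specChar a hw, mse_specChar a hw]
    exact hmax f hf
  refine ⟨⟨hf₀, fun f hf => ?_⟩, hopt, fun hHD => ⟨hHD, ⟨f₀, hf₀, hmse⟩, fun h hh => ?_⟩⟩
  · -- The same `h(f₀)` is an admissible estimate for every `f` in the class.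
    have hmem := specChar_mem_L2s hT ha hw hmin hc₀ hC₀ (hD f hf) ((hmax f hf).trans_lt hfin)
    rw [← hopt.2]
    exact (iInf₂_le _ hmem).trans (hmse f hf)
  · refine (iSup₂_le hmse).trans ?_
    rw [hopt.2]
    exact (iInf₂_le h (Set.mem_iInter₂.1 hh f₀ hf₀)).trans
      (le_iSup₂ (f := fun f (_ : f ∈ D) => mse a h f) f₀ hf₀)

end MinimaxExtrapolation

theorem mainTheorem6 (T : ℕ) (hT : 0 < T) (s : ℕ) (N K : ℕ → ℕ)
    (a : ℕ → ℂ) (ha : Summable fun j => ‖a j‖)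
    (D : Set (ℝ → Matrix (Fin T) (Fin T) ℂ))
    (hD : ∀ f ∈ D, MinimaxExtrapolation.IsSpectralDensity f)
    (f₀ : ℝ → Matrix (Fin T) (Fin T) ℂ) (hf₀ : f₀ ∈ D)
    (hmin : MinimaxExtrapolation.Minimality f₀)
    (c₀ : ℤ → Fin T → ℂ) (C₀ : ℝ → Fin T → ℂ)
    (hc₀ : MinimaxExtrapolation.BSolves (MinimaxExtrapolation.missing s N K) f₀ c₀
      (MinimaxExtrapolation.rhs a))
    (hC₀ : MinimaxExtrapolation.IsSeriesSum (MinimaxExtrapolation.missing s N K) f₀ c₀ C₀)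
    (hmax : ∀ f ∈ D, MinimaxExtrapolation.linFunctional f₀ C₀ f ≤
      MinimaxExtrapolation.linFunctional f₀ C₀ f₀) :
    MinimaxExtrapolation.IsLeastFavorable (MinimaxExtrapolation.missing s N K) a D f₀ ∧
    MinimaxExtrapolation.IsOptimal (MinimaxExtrapolation.missing s N K) a f₀
      (MinimaxExtrapolation.specChar a f₀ C₀) ∧
    (MinimaxExtrapolation.specChar a f₀ C₀ ∈
        MinimaxExtrapolation.HD (MinimaxExtrapolation.missing s N K) D →
      MinimaxExtrapolation.IsMinimax (MinimaxExtrapolation.missing s N K) a D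
        (MinimaxExtrapolation.specChar a f₀ C₀)) :=
  MinimaxExtrapolation.isLeastFavorable_and_isMinimax hT ha hD hf₀ hmin hc₀ hC₀ hmax
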